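/- Let $d\ge 0$ be an integer and let $Z=(X,Y)$ be a random pair with values in $\mathbb{R}^d\times\mathbb{R}$ such that $|Y|\ge Y_L$ almost surely, for a fixed real number $Y_L>0$. Let $(Z_n)_{n\ge1}=(X_n,Y_n)_{n\ge1}$ be independent copies of $Z$ and $D_n=(Z_1,\dots,Z_n)$. Let $l_{MAPE}(p,y)=|p-y|/|y|\in[0,\infty]$, with the conventions $a/0=\infty$ for $a\ne0$ and $0/0=1$. For a measurable $g:\mathbb{R}^d\to\mathbb{R}$ put $L_{MAPE}(g)=\mathbb{E}\big(l_{MAPE}(g(X),Y)\big)$ and $\widehat L_{MAPE}(g,D_n)=\frac1n\sum_{i=1}^n l_{MAPE}(g(X_i),Y_i)$, and let $L^*_{MAPE}$ be the infimum of $L_{MAPE}(g)$ over all measurable functions $g:\mathbb{R}^d\to\mathbb{R}$. For a class $G$ of functions from $\mathbb{R}^d$ to $\mathbb{R}$ let $\|G\|_\infty=\sup_{g\in G}\sup_{x\in\mathbb{R}^d}|g(x)|$, and let $H^+(G,l_{MAPE})$ be the class of the functions $(x,y,t)\mapsto\mathbb{I}_{t\le l_{MAPE}(g(x),y)}$ on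 $\mathbb{R}^d\times\mathbb{R}\times\mathbb{R}$, for $g\in G$. The VC dimension $VC_{dim}(F)$ of a class $F$ of $\{0,1\}$-valued functions is the supremum of the integers $n\ge1$ such that on some $n$ points the functions of $F$ generate all $2^n$ binary vectors (and $0$ if there is no such $n$). Let $(G_n)_{n\ge1}$ be classes of measurable functions from $\mathbb{R}^d$ to $\mathbb{R}$ such that 1. $G_n\subset G_{n+1}$ for all $n\ge 1$; 2. $\bigcup_{n\ge1}G_n$ is dense in $L^1(\mu)$ for every Borel probability measure $\mu$ on $\mathbb{R}^d$; 3. $V_n=VC_{dim}(H^+(G_n,l_{MAPE}))<\infty$ for all $n\ge 1$; 4. $\|G_n\|_\infty<\infty$ for all $n\ge 1$. Assume in addition that $$\lim_{n\to\infty}\frac{V_n\|G_n\|_\infty^2\log\|G_n\|_\infty}{n}=0$$ and that there is $\delta>0$ such that $$\lim_{n\to\infty}\frac{n^{1-\delta}}{\|G_n\|_\infty^2}=\infty .$$ For each $n\ge1$ let $\widehat g_n$ be an empirical risk minimizer over $G_n$: a map $D\mapsto\widehat g_n(D)\in G_n$ defined on $(\mathbb{R}^d\times\mathbb{R})^n$,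 such that $(D,x)\mapsto\widehat g_n(D)(x)$ is measurable and such that almost surely $\widehat L_{MAPE}(\widehat g_n(D_n),D_n)\le\widehat L_{MAPE}(g,D_n)$ for all $g\in G_n$. Then, almost surely, $$\lim_{n\to\infty}L_{MAPE}\big(\widehat g_n(D_n)\big)=L^*_{MAPE}.$$ -/

import Mathlib

open MeasureTheory ProbabilityTheory Filter Topology
open scoped ENNReal

noncomputable section

namespace MAPE

/-- A loss function `l (p, y)` with values in `[0, ∞]`. -/
abbrev Loss : Type := ℝ → ℝ → ℝ≥0∞

/-- The MAPE loss `|p - y| / |y|`, with the conventions `a / 0 = ∞` for `a ≠ 0` and `0 / 0 = 1`. -/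
def mapeLoss : Loss := fun p y =>
  if y = 0 then (if p = 0 then 1 else ∞) else ENNReal.ofReal (|p - y| / |y|)

/-- The input space `ℝ^d`. -/
abbrev Input (d : ℕ) : Type := EuclideanSpace ℝ (Fin d)

/-- The risk `L_l(g) = 𝔼 (l (g X, Y))`, where `ν` is the law of the pair `(X, Y)`. -/
def risk {d : ℕ} (l : Loss) (ν : Measure (Input d × ℝ)) (g : Input d → ℝ) : ℝ≥0∞ :=
  ∫⁻ z, l (g z.1) z.2 ∂ν

/-- The optimal risk `L*_l`: the infimum of the risk over all measurable functions `ℝ^d → ℝ`. -/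
def optimalRisk {d : ℕ} (l : Loss) (ν : Measure (Input d × ℝ)) : ℝ≥0∞ :=
  ⨅ (g : Input d → ℝ) (_ : Measurable g), risk l ν g

/-- The empirical risk `(1 / n) ∑ i, l (g x_i, y_i)` of `g` on a data set of size `n`. -/
def empiricalRisk {d n : ℕ} (l : Loss) (D : Fin n → Input d × ℝ) (g : Input d → ℝ) : ℝ≥0∞ :=
  (∑ i, l (g (D i).1) (D i).2) / (n : ℝ≥0∞)

/-- `g` is an empirical risk minimizer over the class `G` on the data set `D`. -/
def IsERM {d n : ℕ} (l : Loss) (G : Set (Input d → ℝ)) (D : Fin n → Input d × ℝ)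
    (g : Input d → ℝ) : Prop :=
  g ∈ G ∧ ∀ g' ∈ G, empiricalRisk l D g ≤ empiricalRisk l D g'

/-- `‖G‖_∞`, the supremum over `g ∈ G` and `x` of `|g x|`, as an extended nonnegative real. -/
def classNorm {d : ℕ} (G : Set (Input d → ℝ)) : ℝ≥0∞ :=
  ⨆ g ∈ G, ⨆ x, ‖g x‖ₑ

open Classical in
/-- The class `H⁺(G, l)` of the functions `(x, y, t) ↦ 𝟙 (t ≤ l (g x, y))`, for `g ∈ G`. -/
def Hplus {d : ℕ} (G : Set (Input d → ℝ)) (l : Loss) : Set (Input d × ℝ × ℝ → Bool) :=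
  {h | ∃ g ∈ G, h = fun v => decide ((v.2.2 : EReal) ≤ ((l (g v.1) v.2.1 : ℝ≥0∞) : EReal))}

/-- The number of binary vectors that the class `F` generates on the points `z_1, …, z_n`. -/
def patternCount {𝒵 : Type*} {n : ℕ} (F : Set (𝒵 → Bool)) (z : Fin n → 𝒵) : ℕ :=
  Set.ncard {θ : Fin n → Bool | ∃ f ∈ F, θ = fun i => f (z i)}

/-- The `n`-th shatter coefficient: the largest number of binary vectors generated on `n` points
(a supremum of natural numbers that are all at most `2 ^ n`). -/
def shatterCoeff {𝒵 : Type*} (F : Set (𝒵 → Bool)) (n : ℕ) : ℕ :=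
  ⨆ z : Fin n → 𝒵, patternCount F z

/-- The Vapnik-Chervonenkis dimension, with values in `ℕ ∪ {∞}`. -/
def vcDim {𝒵 : Type*} (F : Set (𝒵 → Bool)) : ℕ∞ :=
  ⨆ n ∈ {n : ℕ | 0 < n ∧ shatterCoeff F n = 2 ^ n}, (n : ℕ∞)

/-- The functions of `S` (those that belong to `L¹(μ)`) are dense in `L¹(μ)`. -/
def DenseInL1 {d : ℕ} (S : Set (Input d → ℝ)) (μ : Measure (Input d)) : Prop :=
  Dense {f : Lp ℝ 1 μ | ∃ g ∈ S, (f : Input d → ℝ) =ᵐ[μ] g}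

end MAPE

end

/-!
# Strong consistency of empirical risk minimization for the mean absolute percentage error

The estimator `ghat n` minimizes the empirical risk over `G n`, so its risk is at most
`L̂(g, D_n) + (L(ghat n) - L̂(ghat n, D_n))` for any fixed `g` in one of the classes and `n` large.
The first term tends to `L(g)` by the strong law of large numbers (`ae_tendsto_empiricalRisk`), and
`L(g)` can be taken arbitrarily close to the optimal risk (`exists_risk_lt`): the absolute percentage
error is the absolute error under the finite measure of density `1 / |y|`, so density of the classes
in `L¹` of the normalized first marginal of that measure is exactly what is needed.

It remains to show that the second term is almost surely eventually below any `ε > 0`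
(`ae_eventually_risk_le`). The classes carry no measurability assumption that would make the
supremum of the deviations over `G n` measurable; only the joint measurability of `ghat n` is
available. The bound is therefore proved for the selected function alone (`measure_deviation_le`).
With `B = 1 + ‖G_n‖ / Y_L` a bound on the loss, Jensen's inequality replaces the mean by a ghost
sample (`exp_integral_le_lintegral_exp`), and the exponential moment of the difference between the
ghost sample and the sample is invariant under exchanging the two at each index
(`lintegral_exp_ghost_le`). For a fixed double sample, the average over these exchanges is a finite
sum in which the selected function may vary with the signs, and is controlled by a finite `L¹` cover
of the class on the double sample (`sum_exp_symmetrized_le`).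

The size of the cover must not depend on `n`, since the rate condition involves `log ‖G_n‖` and not
`log n`. On the grid of pairs (sample point, threshold), traces of `H⁺(G_n, l)` at pairwise distance
more than `η` are separated by a random subsample of size about `2 log M / η`, where `M` is their
number; the Sauer-Shelah lemma on that subsample gives `M ≤ 2 (4 / η) ^ (2 V)` (`card_packing_le`).
The resulting probability bound `2 (32 B / ε) ^ (2 V_n) exp (-n ε² / (8 B²))` is summable under the two
rate conditions because `‖G_n‖ → ∞` (`tendsto_classNorm`, `summable_deviation_bound`), and the
Borel-Cantelli lemma concludes.
-/

namespace MAPE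

/-! ### Finite traces of a class of bounded Vapnik-Chervonenkis dimension -/

lemma le_of_forall_trace {𝒵 : Type*} {F : Set (𝒵 → Bool)} {V : ℕ} (hF : vcDim F ≤ V) {k : ℕ}
    (z : Fin k → 𝒵) (hz : ∀ θ : Fin k → Bool, ∃ f ∈ F, θ = fun i => f (z i)) : k ≤ V := by
  rcases Nat.eq_zero_or_pos k with rfl | hk
  · exact Nat.zero_le _
  have hle : ∀ z' : Fin k → 𝒵, patternCount F z' ≤ 2 ^ k := fun z' => by
    have h := Set.ncard_le_ncard (Set.subset_univ {θ : Fin k → Bool | ∃ f ∈ F, θ = fun i => f (z' i)})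
    simpa [patternCount, Set.ncard_univ] using h
  have hpc : patternCount F z = 2 ^ k := by
    have : {θ : Fin k → Bool | ∃ f ∈ F, θ = fun i => f (z i)} = Set.univ :=
      Set.eq_univ_of_forall hz
    simp [patternCount, this, Set.ncard_univ]
  have hsc : shatterCoeff F k = 2 ^ k := by
    have : Nonempty (Fin k → 𝒵) := ⟨z⟩
    refine le_antisymm (ciSup_le hle) ?_
    rw [← hpc]
    exact le_ciSup (f := fun z' : Fin k → 𝒵 => patternCount F z')
      ⟨2 ^ k, by rintro _ ⟨z', rfl⟩; exact hle z'⟩ z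
  have h1 : (k : ℕ∞) ≤ vcDim F :=
    le_iSup₂ (f := fun (n : ℕ) (_ : n ∈ {n : ℕ | 0 < n ∧ shatterCoeff F n = 2 ^ n}) => (n : ℕ∞))
      k ⟨hk, hsc⟩
  exact_mod_cast h1.trans hF

/-- The Sauer-Shelah lemma, for the traces of a class of Boolean functions on `n` points. -/
lemma card_trace_le_sum_choose {𝒵 : Type*} {F : Set (𝒵 → Bool)} {V : ℕ} (hF : vcDim F ≤ V) {n : ℕ}
    (z : Fin n → 𝒵) (T : Finset (Fin n → Bool)) (hT : ∀ θ ∈ T, ∃ f ∈ F, θ = fun i => f (z i)) :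
    T.card ≤ ∑ i ∈ Finset.range (V + 1), n.choose i := by
  classical
  set supp : (Fin n → Bool) → Finset (Fin n) := fun θ => Finset.univ.filter fun i => θ i = true
    with hsupp
  have hmem : ∀ θ i, i ∈ supp θ ↔ θ i = true := fun θ i => by simp [hsupp]
  have hinj : Function.Injective supp := fun θ θ' h => by
    funext i
    have := (hmem θ i).symm.trans ((by rw [h] : i ∈ supp θ ↔ i ∈ supp θ').trans (hmem θ' i))
    exact Bool.eq_iff_iff.2 this
  rw [← Finset.card_image_of_injective T hinj]
  refine (Finset.card_le_card_shatterer _).trans ?_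
  have hsub : (T.image supp).shatterer ⊆
      (Finset.range (V + 1)).biUnion fun i => Finset.powersetCard i Finset.univ := by
    intro s hs
    rw [Finset.mem_shatterer] at hs
    simp only [Finset.mem_biUnion, Finset.mem_range, Finset.mem_powersetCard]
    refine ⟨s.card, Nat.lt_succ_of_le ?_, Finset.subset_univ _, rfl⟩
    refine le_of_forall_trace hF (fun j => z (s.orderEmbOfFin rfl j)) fun θ => ?_
    obtain ⟨u, hu, hut⟩ := hs (t := (Finset.univ.filter fun j => θ j = true).image
      (s.orderEmbOfFin rfl)) (by
        intro a ha
        simp only [Finset.mem_image] at ha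
        obtain ⟨j, -, rfl⟩ := ha
        exact Finset.orderEmbOfFin_mem _ _ _)
    obtain ⟨θ', hθ', rfl⟩ := Finset.mem_image.1 hu
    obtain ⟨f, hf, rfl⟩ := hT θ' hθ'
    refine ⟨f, hf, ?_⟩
    funext j
    have h := Finset.ext_iff.1 hut (s.orderEmbOfFin rfl j)
    simp only [Finset.mem_inter, Finset.orderEmbOfFin_mem, true_and, hmem, Finset.mem_image,
      Finset.mem_filter, Finset.mem_univ, EmbeddingLike.apply_eq_iff_eq, exists_eq_right] at h
    exact Bool.eq_iff_iff.2 h.symm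
  refine (Finset.card_le_card hsub).trans (Finset.card_biUnion_le.trans ?_)
  simp

lemma sum_choose_le_exp (n V : ℕ) {x : ℝ} (hx : 0 < x) (hx1 : x ≤ 1) :
    (∑ i ∈ Finset.range (V + 1), (n.choose i : ℝ)) ≤ (x⁻¹) ^ V * Real.exp (x * n) := by
  have h1 : ∀ i ∈ Finset.range (V + 1), (n.choose i : ℝ) ≤ (x⁻¹) ^ V * (x ^ i * n.choose i) := by
    intro i hi
    have hi' : i ≤ V := Nat.lt_succ_iff.1 (Finset.mem_range.1 hi)
    have h2 : x ^ V ≤ x ^ i := pow_le_pow_of_le_one hx.le hx1 hi'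
    have h3 : 1 ≤ (x⁻¹) ^ V * x ^ i := by
      rw [inv_pow, inv_mul_eq_div, le_div_iff₀ (by positivity), one_mul]
      exact h2
    rw [← mul_assoc]
    exact le_mul_of_one_le_left (Nat.cast_nonneg _) h3
  refine (Finset.sum_le_sum h1).trans ?_
  rw [← Finset.mul_sum]
  refine mul_le_mul_of_nonneg_left ?_ (by positivity)
  calc ∑ i ∈ Finset.range (V + 1), x ^ i * (n.choose i : ℝ)
      ≤ ∑ i ∈ Finset.range (n + 1 + V), x ^ i * (n.choose i : ℝ) :=
        Finset.sum_le_sum_of_subset_of_nonneg (Finset.range_mono (by omega))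
          fun i _ _ => by positivity
    _ = ∑ i ∈ Finset.range (n + 1), x ^ i * (n.choose i : ℝ) := by
        symm
        refine Finset.sum_subset (Finset.range_mono (by omega)) fun i _ hi => ?_
        rw [Nat.choose_eq_zero_of_lt (by simpa using hi)]
        simp
    _ = (x + 1) ^ n := by rw [add_pow]; simp
    _ ≤ Real.exp x ^ n := by gcongr; exact Real.add_one_le_exp x
    _ = Real.exp (x * n) := by rw [← Real.exp_nat_mul, mul_comm]

/-! ### Packing and covering numbers -/

/-- Traces that pairwise differ on more than a fraction `η` of the points `w` are separated by
some sample of about `2 log M / η` of these points, where `M` is their number. -/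
lemma exists_separating_sample {ι : Type*} [Fintype ι] [Nonempty ι]
    {η : ℝ} (T : Finset (ι → Bool))
    (hsep : ∀ θ ∈ T, ∀ θ' ∈ T, θ ≠ θ' →
      η * Fintype.card ι < (Finset.univ.filter fun i => θ i ≠ θ' i).card)
    {K : ℕ} (hK : 2 * Real.log T.card ≤ η * K) (hT : T.Nonempty) :
    ∃ s : Fin K → ι, Set.InjOn (fun (θ : ι → Bool) (j : Fin K) => θ (s j)) T := by
  classical
  by_contra! hcon
  have hM : (0 : ℝ) < T.card := by exact_mod_cast hT.card_pos
  have hN : (0 : ℝ) < Fintype.card ι := by exact_mod_cast Fintype.card_pos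
  have hcover : (Finset.univ : Finset (Fin K → ι)) ⊆ T.offDiag.biUnion fun p =>
      Fintype.piFinset fun _ : Fin K => Finset.univ.filter fun i => p.1 i = p.2 i := by
    intro s _
    have h := hcon s
    simp only [Set.InjOn] at h
    push Not at h
    obtain ⟨θ, hθ, θ', hθ', heq, hne⟩ := h
    refine Finset.mem_biUnion.2 ⟨(θ, θ'), Finset.mem_offDiag.2 ⟨hθ, hθ', hne⟩, ?_⟩
    simp only [Fintype.mem_piFinset, Finset.mem_filter, Finset.mem_univ, true_and]
    exact fun j => congrFun heq j
  have hcard := (Finset.card_le_card hcover).trans Finset.card_biUnion_le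
  have hagree : ∀ p ∈ T.offDiag,
      ((Fintype.piFinset fun _ : Fin K => Finset.univ.filter fun i => p.1 i = p.2 i).card : ℝ) ≤
        Real.exp (-(η * K)) * (Fintype.card ι : ℝ) ^ K := by
    intro p hp
    rw [Finset.mem_offDiag] at hp
    have h1 := hsep _ hp.1 _ hp.2.1 hp.2.2
    have h2 := Finset.card_filter_add_card_filter_not (s := (Finset.univ : Finset ι))
      (fun i => p.1 i = p.2 i)
    have h3 : ((Finset.univ.filter fun i => p.1 i = p.2 i).card : ℝ) +
        (Finset.univ.filter fun i => p.1 i ≠ p.2 i).card = Fintype.card ι := by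
      exact_mod_cast h2
    have h4 : ((Finset.univ.filter fun i => p.1 i = p.2 i).card : ℝ) ≤
        Real.exp (-η) * Fintype.card ι := by
      have := Real.add_one_le_exp (-η)
      nlinarith
    rw [Fintype.card_piFinset]
    simp only [Finset.prod_const, Finset.card_univ, Fintype.card_fin, Nat.cast_pow]
    calc _ ≤ (Real.exp (-η) * Fintype.card ι) ^ K := by gcongr
      _ = _ := by rw [mul_pow, ← Real.exp_nat_mul]; ring_nf
  have hexp : Real.exp (-(η * K)) ≤ 1 / (T.card : ℝ) ^ 2 := by
    rw [one_div, ← Real.exp_log (pow_pos hM 2), ← Real.exp_neg, Real.exp_le_exp, Real.log_pow]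
    push_cast
    linarith
  have hoff : (T.offDiag.card : ℝ) < (T.card : ℝ) ^ 2 := by
    have h : T.offDiag.card + T.card = T.card * T.card := by
      rw [Finset.offDiag_card]
      exact Nat.sub_add_cancel (Nat.le_mul_self _)
    have h' : (T.offDiag.card : ℝ) + T.card = T.card * T.card := by exact_mod_cast h
    nlinarith
  have hfin : (Fintype.card ι : ℝ) ^ K ≤
      T.offDiag.card * (1 / (T.card : ℝ) ^ 2 * (Fintype.card ι : ℝ) ^ K) := by
    calc (Fintype.card ι : ℝ) ^ K = ((Finset.univ : Finset (Fin K → ι)).card : ℝ) := by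
          simp
      _ ≤ ∑ p ∈ T.offDiag, ((Fintype.piFinset fun _ : Fin K =>
            Finset.univ.filter fun i => p.1 i = p.2 i).card : ℝ) := by exact_mod_cast hcard
      _ ≤ ∑ _p ∈ T.offDiag, 1 / (T.card : ℝ) ^ 2 * (Fintype.card ι : ℝ) ^ K := by
          refine Finset.sum_le_sum fun p hp => (hagree p hp).trans ?_
          gcongr
      _ = _ := by simp
  have hpos : (0 : ℝ) < (Fintype.card ι : ℝ) ^ K := by positivity
  have : (T.offDiag.card : ℝ) * (1 / (T.card : ℝ) ^ 2 * (Fintype.card ι : ℝ) ^ K) <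
      (T.card : ℝ) ^ 2 * (1 / (T.card : ℝ) ^ 2 * (Fintype.card ι : ℝ) ^ K) :=
    mul_lt_mul_of_pos_right hoff (by positivity)
  have h5 : (T.card : ℝ) ^ 2 * (1 / (T.card : ℝ) ^ 2 * (Fintype.card ι : ℝ) ^ K) =
      (Fintype.card ι : ℝ) ^ K := by field_simp
  linarith

/-- A bound on packing numbers that does not depend on the number of points. -/
lemma card_packing_le {𝒵 : Type*} {F : Set (𝒵 → Bool)} {V : ℕ} (hF : vcDim F ≤ V)
    {ι : Type*} [Fintype ι] [Nonempty ι] (w : ι → 𝒵) {η : ℝ} (hη : 0 < η) (hη1 : η ≤ 1)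
    (T : Finset (ι → Bool)) (hT : ∀ θ ∈ T, ∃ f ∈ F, θ = fun i => f (w i))
    (hsep : ∀ θ ∈ T, ∀ θ' ∈ T, θ ≠ θ' →
      η * Fintype.card ι < (Finset.univ.filter fun i => θ i ≠ θ' i).card) :
    (T.card : ℝ) ≤ 2 * (4 / η) ^ (2 * V) := by
  classical
  rcases T.eq_empty_or_nonempty with rfl | hne
  · simp only [Finset.card_empty, Nat.cast_zero]; positivity
  have hM : (1 : ℝ) ≤ T.card := by exact_mod_cast hne.card_pos
  have hlog : 0 ≤ Real.log T.card := Real.log_nonneg hM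
  set K : ℕ := ⌈2 * Real.log T.card / η⌉₊ with hKdef
  have hK1 : 2 * Real.log T.card / η ≤ K := Nat.le_ceil _
  have hK2 : (K : ℝ) < 2 * Real.log T.card / η + 1 := Nat.ceil_lt_add_one (by positivity)
  have hK1' : 2 * Real.log T.card ≤ η * K := by
    rw [div_le_iff₀ hη] at hK1; linarith
  have hK2' : η * K ≤ 2 * Real.log T.card + 1 := by
    have h := mul_lt_mul_of_pos_left hK2 hη
    have h' : η * (2 * Real.log T.card / η + 1) = 2 * Real.log T.card + η := by field_simp
    linarith
  obtain ⟨s, hs⟩ := exists_separating_sample T hsep hK1' hne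
  have hcard : T.card ≤ ∑ i ∈ Finset.range (V + 1), K.choose i := by
    rw [← Finset.card_image_of_injOn hs]
    refine card_trace_le_sum_choose hF (fun j => w (s j)) _ fun θ hθ => ?_
    obtain ⟨θ', hθ', rfl⟩ := Finset.mem_image.1 hθ
    obtain ⟨f, hf, rfl⟩ := hT θ' hθ'
    exact ⟨f, hf, rfl⟩
  -- The choice `x = η / 4` lets the exponential factor absorb only the square root of `#T`.
  have hbound : (T.card : ℝ) ≤ ((η / 4)⁻¹) ^ V * Real.exp (η / 4 * K) := by
    refine le_trans ?_ (sum_choose_le_exp K V (by positivity : (0 : ℝ) < η / 4) (by linarith))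
    exact_mod_cast hcard
  have hinv : (η / 4)⁻¹ = 4 / η := by rw [inv_div]
  have hpos : (0 : ℝ) < 4 / η := by positivity
  rw [hinv] at hbound
  have hl : Real.log T.card ≤ V * Real.log (4 / η) + η / 4 * K := by
    have h := Real.log_le_log (by linarith) hbound
    rwa [Real.log_mul (by positivity) (Real.exp_pos _).ne', Real.log_exp, Real.log_pow] at h
  have hl2 : Real.log T.card ≤ (2 * V : ℕ) * Real.log (4 / η) + Real.log 2 := by
    have := Real.log_two_gt_d9
    push_cast
    linarith
  rw [← Real.log_pow, ← Real.log_mul (by positivity) (by norm_num)] at hl2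
  have := (Real.log_le_log_iff (by linarith) (by positivity)).1 hl2
  linarith

lemma exists_trace_cover {𝒵 : Type*} {F : Set (𝒵 → Bool)} {V : ℕ} (hF : vcDim F ≤ V)
    {ι : Type*} [Fintype ι] [Nonempty ι] (w : ι → 𝒵) {η : ℝ} (hη : 0 < η) (hη1 : η ≤ 1) :
    ∃ C : Finset (ι → Bool), (C.card : ℝ) ≤ 2 * (4 / η) ^ (2 * V) ∧
      ∀ f ∈ F, ∃ c ∈ C,
        ((Finset.univ.filter fun i => f (w i) ≠ c i).card : ℝ) ≤ η * Fintype.card ι := by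
  classical
  -- A packing of maximal cardinality is a cover.
  let Pk : Finset (ι → Bool) → Prop := fun T =>
    (∀ θ ∈ T, ∃ f ∈ F, θ = fun i => f (w i)) ∧ ∀ θ ∈ T, ∀ θ' ∈ T, θ ≠ θ' →
      η * Fintype.card ι < (Finset.univ.filter fun i => θ i ≠ θ' i).card
  obtain ⟨C, hC, hmax⟩ := Finset.exists_max_image (Finset.univ.filter Pk) Finset.card
    ⟨∅, by simp [Pk]⟩
  simp only [Finset.mem_filter, Finset.mem_univ, true_and] at hC hmax
  refine ⟨C, card_packing_le hF w hη hη1 C hC.1 hC.2, fun f hf => ?_⟩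
  by_contra! hcon
  set θ : ι → Bool := fun i => f (w i) with hθ
  have hnot : θ ∉ C := fun hmem => by
    have := hcon θ hmem
    simp only [hθ, ne_eq, not_true_eq_false, Finset.filter_false, Finset.card_empty,
      Nat.cast_zero] at this
    exact absurd this (not_lt.2 (by positivity))
  have hins : Pk (insert θ C) := by
    refine ⟨fun θ' h => ?_, fun θ₁ h₁ θ₂ h₂ hne => ?_⟩
    · rcases Finset.mem_insert.1 h with rfl | h
      · exact ⟨f, hf, rfl⟩
      · exact hC.1 _ h
    · rcases Finset.mem_insert.1 h₁ with rfl | h₁ <;> rcases Finset.mem_insert.1 h₂ with rfl | h₂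
      · exact absurd rfl hne
      · exact hcon _ h₂
      · have := hcon _ h₁
        simpa only [ne_comm] using this
      · exact hC.2 _ h₁ _ h₂ hne
  have := hmax _ hins
  rw [Finset.card_insert_of_notMem hnot] at this
  omega

lemma abs_sub_card_thresholds_le {B u : ℝ} (hB : 0 < B) (hu : u ∈ Set.Icc 0 B) {K : ℕ}
    (hK : 0 < K) :
    |u - B / K * ((Finset.univ.filter fun k : Fin K => B * (k + 1) / K ≤ u).card : ℝ)| ≤
      B / K := by
  have hK' : (0 : ℝ) < K := by exact_mod_cast hK
  set m : ℕ := ⌊u * K / B⌋₊ with hm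
  have hmK : m ≤ K := by
    refine Nat.floor_le_of_le ?_
    rw [div_le_iff₀ hB]
    nlinarith [hu.2]
  have hcard : (Finset.univ.filter fun k : Fin K => B * (k + 1) / K ≤ u).card = m := by
    have : (Finset.univ.filter fun k : Fin K => B * (k + 1) / K ≤ u) =
        Finset.univ.filter fun k : Fin K => (k : ℕ) < m := by
      ext k
      simp only [Finset.mem_filter, Finset.mem_univ, true_and]
      rw [← Nat.succ_le_iff, hm, Nat.le_floor_iff (by have := hu.1; positivity)]
      rw [div_le_iff₀ hK', le_div_iff₀ hB]
      push_cast
      rw [mul_comm]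
    rw [this, Fin.card_filter_val_lt, min_eq_right hmK]
  rw [hcard]
  have h1 : (m : ℝ) ≤ u * K / B := Nat.floor_le (by have := hu.1; positivity)
  have h2 : u * K / B < m + 1 := Nat.lt_floor_add_one _
  have e : u = B / K * (u * K / B) := by field_simp
  have hp : 0 < B / K := by positivity
  rw [abs_le]
  constructor
  · nlinarith
  · nlinarith

/-- An `L¹` cover of a class of `[0, B]`-valued functions on finitely many points, in terms of the
Vapnik-Chervonenkis dimension of the threshold sets. The element `e ζ t` encodes the pair of a point
and a threshold, and `u` ranges over the vectors of values of the functions of the class. -/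
lemma exists_function_cover {𝒵 𝒲 : Type*} {F : Set (𝒲 → Bool)} {V : ℕ} (hF : vcDim F ≤ V)
    (e : 𝒵 → ℝ → 𝒲) {B : ℝ} (hB : 0 < B) {κ : Type*} [Fintype κ] [Nonempty κ] (ζ : κ → 𝒵)
    {η : ℝ} (hη : 0 < η) (hη1 : η ≤ 1) :
    ∃ C : Finset (κ → ℝ), (C.card : ℝ) ≤ 2 * (4 / η) ^ (2 * V) ∧
      (∀ c ∈ C, ∀ i, c i ∈ Set.Icc 0 B) ∧
      ∀ u : κ → ℝ, (∀ i, u i ∈ Set.Icc 0 B) →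
        (∃ φ ∈ F, ∀ i t, 0 < t → t ≤ B → (φ (e (ζ i) t) = true ↔ t ≤ u i)) →
        ∃ c ∈ C, ∑ i, |u i - c i| ≤ 2 * B * η * Fintype.card κ := by
  classical
  set K : ℕ := ⌈η⁻¹⌉₊ with hKdef
  have hK : 0 < K := Nat.ceil_pos.2 (by positivity)
  have hK' : (0 : ℝ) < K := by exact_mod_cast hK
  have hKη : (K : ℝ)⁻¹ ≤ η := inv_le_of_inv_le₀ hη (Nat.le_ceil _)
  have : Nonempty (Fin K) := ⟨⟨0, hK⟩⟩
  obtain ⟨C, hCcard, hC⟩ := exists_trace_cover hF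
    (fun p : κ × Fin K => e (ζ p.1) (B * (p.2 + 1) / K)) hη hη1
  set vec : (κ × Fin K → Bool) → κ → ℝ := fun c i =>
    B / K * ((Finset.univ.filter fun k : Fin K => c (i, k) = true).card : ℝ) with hvec
  refine ⟨C.image vec, le_trans (by exact_mod_cast Finset.card_image_le) hCcard, ?_, ?_⟩
  · intro c hc i
    obtain ⟨c', -, rfl⟩ := Finset.mem_image.1 hc
    refine ⟨by positivity, ?_⟩
    have h : ((Finset.univ.filter fun k : Fin K => c' (i, k) = true).card : ℝ) ≤ K := by
      exact_mod_cast (Finset.card_filter_le _ _).trans (by simp)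
    calc vec c' i ≤ B / K * K := by
          simp only [hvec]; gcongr
      _ = B := by field_simp
  · rintro u hu ⟨φ, hφ, hφu⟩
    obtain ⟨c, hc, hcd⟩ := hC φ hφ
    refine ⟨vec c, Finset.mem_image_of_mem _ hc, ?_⟩
    set θ : κ × Fin K → Bool := fun p => φ (e (ζ p.1) (B * (p.2 + 1) / K)) with hθ
    have h1 : ∀ i, |u i - vec θ i| ≤ B / K := fun i => by
      have h := abs_sub_card_thresholds_le hB (hu i) hK
      have hset : (Finset.univ.filter fun k : Fin K => B * (k + 1) / K ≤ u i) =
          Finset.univ.filter fun k : Fin K => θ (i, k) = true := by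
        ext k
        simp only [Finset.mem_filter, Finset.mem_univ, true_and, hθ]
        refine (hφu i _ (by positivity) ?_).symm
        rw [div_le_iff₀ hK']
        have : (k : ℝ) + 1 ≤ K := by exact_mod_cast k.2
        gcongr
      rwa [hset] at h
    have h2 : ∀ i, |vec θ i - vec c i| ≤
        B / K * ((Finset.univ.filter fun k : Fin K => θ (i, k) ≠ c (i, k)).card : ℝ) := fun i => by
      simp only [hvec]
      rw [← mul_sub, abs_mul, abs_of_pos (by positivity : 0 < B / K)]
      gcongr
      simp only [Finset.card_filter, Nat.cast_sum, ← Finset.sum_sub_distrib]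
      refine (Finset.abs_sum_le_sum_abs _ _).trans (Finset.sum_le_sum fun k _ => ?_)
      cases θ (i, k) <;> cases c (i, k) <;> simp
    have h3 : ∑ i, ((Finset.univ.filter fun k : Fin K => θ (i, k) ≠ c (i, k)).card : ℝ) =
        ((Finset.univ.filter fun p : κ × Fin K => θ p ≠ c p).card : ℝ) := by
      simp only [Finset.card_filter, Nat.cast_sum]
      rw [Fintype.sum_prod_type]
    have h4 : ((Finset.univ.filter fun p : κ × Fin K => θ p ≠ c p).card : ℝ) ≤
        η * (Fintype.card κ * K) := by
      have := hcd
      simpa [Fintype.card_prod] using this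
    calc ∑ i, |u i - vec c i|
        ≤ ∑ i, (B / K + B / K *
            ((Finset.univ.filter fun k : Fin K => θ (i, k) ≠ c (i, k)).card : ℝ)) :=
          Finset.sum_le_sum fun i _ =>
            (abs_sub_le _ (vec θ i) _).trans (add_le_add (h1 i) (h2 i))
      _ = Fintype.card κ * (B / K) + B / K *
            ((Finset.univ.filter fun p : κ × Fin K => θ p ≠ c p).card : ℝ) := by
          rw [Finset.sum_add_distrib, ← Finset.mul_sum, h3]
          simp
      _ ≤ Fintype.card κ * (B * η) + B / K * (η * (Fintype.card κ * K)) := by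
          gcongr
          rw [div_eq_mul_inv]
          gcongr
      _ = 2 * B * η * Fintype.card κ := by field_simp; ring

/-! ### Rademacher averages -/

lemma sum_exp_rademacher_le {n : ℕ} (a : Fin n → ℝ) {B : ℝ} (ha : ∀ i, |a i| ≤ B) (s : ℝ) :
    ∑ σ : Fin n → Bool, Real.exp (s * ∑ i, (if σ i then -a i else a i)) ≤
      2 ^ n * Real.exp (n * (s ^ 2 * B ^ 2 / 2)) := by
  have h1 : ∀ σ : Fin n → Bool, Real.exp (s * ∑ i, (if σ i then -a i else a i)) =
      ∏ i, Real.exp (s * if σ i then -a i else a i) := fun σ => by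
    rw [Finset.mul_sum, Real.exp_sum]
  simp only [h1]
  have h2 := Finset.prod_univ_sum (fun _ : Fin n => (Finset.univ : Finset Bool))
    (fun i b => Real.exp (s * if b then -a i else a i))
  rw [Fintype.piFinset_univ] at h2
  rw [← h2]
  have h3 : ∀ i, ∑ b : Bool, Real.exp (s * if b then -a i else a i) ≤
      2 * Real.exp (s ^ 2 * B ^ 2 / 2) := fun i => by
    have hc := Real.cosh_le_exp_half_sq (s * a i)
    rw [Real.cosh_eq] at hc
    have hsq : (a i) ^ 2 ≤ B ^ 2 := sq_le_sq' (abs_le.1 (ha i)).1 (abs_le.1 (ha i)).2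
    have hm : Real.exp ((s * a i) ^ 2 / 2) ≤ Real.exp (s ^ 2 * B ^ 2 / 2) := by
      rw [mul_pow]; gcongr
    simp only [Fintype.sum_bool, if_true, Bool.false_eq_true, if_false, mul_neg]
    linarith
  calc ∏ i, ∑ b : Bool, Real.exp (s * if b then -a i else a i)
      ≤ ∏ _i : Fin n, 2 * Real.exp (s ^ 2 * B ^ 2 / 2) :=
        Finset.prod_le_prod (fun i _ => Finset.sum_nonneg fun b _ => (Real.exp_pos _).le)
          fun i _ => h3 i
    _ = _ := by
        rw [Finset.prod_const, Finset.card_univ, Fintype.card_fin, mul_pow, ← Real.exp_nat_mul]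

/-- A maximal inequality over the signs `σ`, in which the function `u σ` of the class may depend on
the signs: no measurability of a supremum over the class is involved. -/
lemma sum_exp_symmetrized_le {𝒵 𝒲 : Type*} {F : Set (𝒲 → Bool)} {V : ℕ} (hF : vcDim F ≤ V)
    (e : 𝒵 → ℝ → 𝒲) {B : ℝ} (hB : 0 < B) {n : ℕ} (hn : 0 < n) (p : Fin n → 𝒵 × 𝒵)
    (u : (Fin n → Bool) → 𝒵 → ℝ) (hu : ∀ σ z, u σ z ∈ Set.Icc 0 B)
    (huF : ∀ σ, ∃ φ ∈ F, ∀ z t, 0 < t → t ≤ B → (φ (e z t) = true ↔ t ≤ u σ z))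
    {η : ℝ} (hη : 0 < η) (hη1 : η ≤ 1) {s : ℝ} (hs : 0 ≤ s) :
    ∑ σ : Fin n → Bool, Real.exp (s * ∑ i, (if σ i then -(u σ (p i).2 - u σ (p i).1)
        else u σ (p i).2 - u σ (p i).1)) ≤
      2 ^ n * (2 * (4 / η) ^ (2 * V) *
        Real.exp (n * (4 * s * B * η) + n * (s ^ 2 * B ^ 2 / 2))) := by
  classical
  have : Nonempty (Fin n) := ⟨⟨0, hn⟩⟩
  set ζ : Fin n × Bool → 𝒵 := fun q => if q.2 then (p q.1).2 else (p q.1).1 with hζ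
  obtain ⟨C, hCcard, hCB, hC⟩ := exists_function_cover hF e hB ζ hη hη1
  set R : (Fin n × Bool → ℝ) → (Fin n → Bool) → ℝ := fun c σ =>
    ∑ i, (if σ i then -(c (i, true) - c (i, false)) else c (i, true) - c (i, false)) with hR
  have hstep : ∀ σ : Fin n → Bool,
      Real.exp (s * ∑ i, (if σ i then -(u σ (p i).2 - u σ (p i).1)
        else u σ (p i).2 - u σ (p i).1)) ≤
      ∑ c ∈ C, Real.exp (n * (4 * s * B * η)) * Real.exp (s * R c σ) := fun σ => by
    obtain ⟨c, hc, hcd⟩ := hC (fun q => u σ (ζ q)) (fun q => hu σ _)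
      (by
        obtain ⟨φ, hφ, h⟩ := huF σ
        exact ⟨φ, hφ, fun q t h0 h1 => h _ t h0 h1⟩)
    refine le_trans ?_ (Finset.single_le_sum
      (f := fun c => Real.exp (n * (4 * s * B * η)) * Real.exp (s * R c σ))
      (fun c _ => by positivity) hc)
    rw [← Real.exp_add, Real.exp_le_exp]
    have hd : ∑ i, (if σ i then -(u σ (p i).2 - u σ (p i).1) else u σ (p i).2 - u σ (p i).1) ≤
        R c σ + ∑ q, |u σ (ζ q) - c q| := by
      rw [Fintype.sum_prod_type, hR, ← Finset.sum_add_distrib]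
      refine Finset.sum_le_sum fun i _ => ?_
      simp only [Fintype.sum_bool, hζ, if_true, Bool.false_eq_true, if_false]
      have h1 := abs_le.1 (le_refl |u σ (p i).2 - c (i, true)|)
      have h2 := abs_le.1 (le_refl |u σ (p i).1 - c (i, false)|)
      split_ifs <;> linarith [h1.1, h1.2, h2.1, h2.2]
    have hd2 : ∑ q, |u σ (ζ q) - c q| ≤ n * (4 * B * η) := by
      refine hcd.trans (le_of_eq ?_)
      simp only [Fintype.card_prod, Fintype.card_fin, Fintype.card_bool]
      push_cast
      ring
    calc s * _ ≤ s * (R c σ + n * (4 * B * η)) := by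
          refine mul_le_mul_of_nonneg_left ?_ hs
          linarith
      _ = _ := by ring
  have hrad : ∀ c ∈ C, ∑ σ : Fin n → Bool, Real.exp (s * R c σ) ≤
      2 ^ n * Real.exp (n * (s ^ 2 * B ^ 2 / 2)) := fun c hc => by
    refine sum_exp_rademacher_le (fun i => c (i, true) - c (i, false)) (fun i => ?_) s
    have h1 := hCB c hc (i, true)
    have h2 := hCB c hc (i, false)
    rw [abs_le]
    constructor <;> linarith [h1.1, h1.2, h2.1, h2.2]
  calc _ ≤ ∑ σ : Fin n → Bool, ∑ c ∈ C,
          Real.exp (n * (4 * s * B * η)) * Real.exp (s * R c σ) :=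
        Finset.sum_le_sum fun σ _ => hstep σ
    _ = ∑ c ∈ C, Real.exp (n * (4 * s * B * η)) * ∑ σ : Fin n → Bool, Real.exp (s * R c σ) := by
        rw [Finset.sum_comm]
        simp only [Finset.mul_sum]
    _ ≤ ∑ _c ∈ C, Real.exp (n * (4 * s * B * η)) *
          (2 ^ n * Real.exp (n * (s ^ 2 * B ^ 2 / 2))) :=
        Finset.sum_le_sum fun c hc => mul_le_mul_of_nonneg_left (hrad c hc) (Real.exp_pos _).le
    _ = 2 ^ n * (C.card * Real.exp (n * (4 * s * B * η) + n * (s ^ 2 * B ^ 2 / 2))) := by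
        rw [Finset.sum_const, nsmul_eq_mul, Real.exp_add]
        ring
    _ ≤ _ := by gcongr

/-! ### Symmetrization with a ghost sample -/

lemma measurePreserving_swap_coordinates {𝒵 : Type*} [MeasurableSpace 𝒵] (ν : Measure 𝒵)
    [IsProbabilityMeasure ν] {n : ℕ} (σ : Fin n → Bool) :
    MeasurePreserving (fun (p : Fin n → 𝒵 × 𝒵) i => if σ i then (p i).swap else p i)
      (Measure.pi fun _ => ν.prod ν) (Measure.pi fun _ => ν.prod ν) := by
  refine measurePreserving_pi (fun _ : Fin n => ν.prod ν) (fun _ => ν.prod ν)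
    (f := fun i q => if σ i then q.swap else q) fun i => ?_
  cases σ i
  · exact MeasurePreserving.id (ν.prod ν)
  · simpa using Measure.measurePreserving_swap (μ := ν) (ν := ν)

/-- The exponential moment of the gap between a second sample and the sample that selects the
function. -/
lemma lintegral_exp_ghost_le {𝒵 𝒲 : Type*} [MeasurableSpace 𝒵] (ν : Measure 𝒵)
    [IsProbabilityMeasure ν] {F : Set (𝒲 → Bool)} {V : ℕ} (hF : vcDim F ≤ V)
    (e : 𝒵 → ℝ → 𝒲) {B : ℝ} (hB : 0 < B) {n : ℕ} (hn : 0 < n) (h : (Fin n → 𝒵) → 𝒵 → ℝ)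
    (hmeas : Measurable (Function.uncurry h)) (hhB : ∀ D z, h D z ∈ Set.Icc 0 B)
    (hhF : ∀ D, ∃ φ ∈ F, ∀ z t, 0 < t → t ≤ B → (φ (e z t) = true ↔ t ≤ h D z))
    {η : ℝ} (hη : 0 < η) (hη1 : η ≤ 1) {s : ℝ} (hs : 0 ≤ s) :
    ∫⁻ p, ENNReal.ofReal (Real.exp (s * ∑ i, (h (fun j => (p j).1) (p i).2 -
        h (fun j => (p j).1) (p i).1))) ∂(Measure.pi fun _ : Fin n => ν.prod ν) ≤
      ENNReal.ofReal (2 * (4 / η) ^ (2 * V) *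
        Real.exp (n * (4 * s * B * η) + n * (s ^ 2 * B ^ 2 / 2))) := by
  set π : Measure (Fin n → 𝒵 × 𝒵) := Measure.pi fun _ : Fin n => ν.prod ν with hπ
  set Q : (Fin n → 𝒵 × 𝒵) → ℝ := fun p => Real.exp (s * ∑ i,
    (h (fun j => (p j).1) (p i).2 - h (fun j => (p j).1) (p i).1)) with hQ
  set sw : (Fin n → Bool) → (Fin n → 𝒵 × 𝒵) → (Fin n → 𝒵 × 𝒵) :=
    fun σ p i => if σ i then (p i).swap else p i with hsw
  have hm1 : Measurable fun p : Fin n → 𝒵 × 𝒵 => fun j => (p j).1 :=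
    measurable_pi_lambda _ fun j => (measurable_pi_apply j).fst
  have hQm : Measurable Q := by
    refine Real.measurable_exp.comp (Measurable.const_mul ?_ s)
    refine Finset.measurable_sum _ fun i _ => Measurable.sub ?_ ?_
    · exact hmeas.comp (hm1.prodMk (measurable_pi_apply i).snd)
    · exact hmeas.comp (hm1.prodMk (measurable_pi_apply i).fst)
  have hmp : ∀ σ, MeasurePreserving (sw σ) π π := fun σ => measurePreserving_swap_coordinates ν σ
  have hinv : ∀ σ, ∫⁻ p, ENNReal.ofReal (Q (sw σ p)) ∂π = ∫⁻ p, ENNReal.ofReal (Q p) ∂π :=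
    fun σ => (hmp σ).lintegral_comp hQm.ennreal_ofReal
  set A : ℝ := 2 * (4 / η) ^ (2 * V) *
    Real.exp (n * (4 * s * B * η) + n * (s ^ 2 * B ^ 2 / 2)) with hA
  have hA0 : 0 ≤ A := by positivity
  have hpt : ∀ p, ∑ σ : Fin n → Bool, ENNReal.ofReal (Q (sw σ p)) ≤
      ENNReal.ofReal (2 ^ n * A) := fun p => by
    rw [← ENNReal.ofReal_sum_of_nonneg fun σ _ => (Real.exp_pos _).le]
    refine ENNReal.ofReal_le_ofReal ?_
    refine le_of_eq_of_le ?_ (sum_exp_symmetrized_le hF e hB hn p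
      (fun σ => h fun j => (sw σ p j).1) (fun σ z => hhB _ z) (fun σ => hhF _) hη hη1 hs)
    refine Finset.sum_congr rfl fun σ _ => ?_
    congr 2
    refine Finset.sum_congr rfl fun i _ => ?_
    generalize h (fun j => (sw σ p j).1) = g
    cases hσ : σ i <;> simp [hsw, hσ]
  have hsum : (2 : ℝ≥0∞) ^ n * ∫⁻ p, ENNReal.ofReal (Q p) ∂π ≤ 2 ^ n * ENNReal.ofReal A := by
    calc (2 : ℝ≥0∞) ^ n * ∫⁻ p, ENNReal.ofReal (Q p) ∂π
        = ∑ σ : Fin n → Bool, ∫⁻ p, ENNReal.ofReal (Q (sw σ p)) ∂π := by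
          simp [hinv]
      _ = ∫⁻ p, ∑ σ : Fin n → Bool, ENNReal.ofReal (Q (sw σ p)) ∂π := by
          rw [lintegral_finsetSum]
          exact fun σ _ => (hQm.comp (hmp σ).measurable).ennreal_ofReal
      _ ≤ ∫⁻ _p, ENNReal.ofReal (2 ^ n * A) ∂π := lintegral_mono hpt
      _ = 2 ^ n * ENNReal.ofReal A := by
          rw [lintegral_const, measure_univ, mul_one, ENNReal.ofReal_mul (by positivity),
            ENNReal.ofReal_pow (by norm_num), ENNReal.ofReal_ofNat]
  exact (ENNReal.mul_le_mul_iff_right (by positivity) (by finiteness)).1 hsum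

/-- Jensen's inequality replaces the mean of a bounded function by its sum over an independent
sample. -/
lemma exp_integral_le_lintegral_exp {𝒵 : Type*} [MeasurableSpace 𝒵] (ν : Measure 𝒵)
    [IsProbabilityMeasure ν] {B : ℝ} {n : ℕ} (g : 𝒵 → ℝ) (hg : Measurable g)
    (hgB : ∀ z, g z ∈ Set.Icc 0 B) (s c : ℝ) :
    ENNReal.ofReal (Real.exp (s * (n * ∫ z, g z ∂ν - c))) ≤
      ∫⁻ D', ENNReal.ofReal (Real.exp (s * (∑ i, g (D' i) - c)))
        ∂(Measure.pi fun _ : Fin n => ν) := by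
  set π : Measure (Fin n → 𝒵) := Measure.pi fun _ : Fin n => ν with hπ
  have hgi : Integrable g ν := Integrable.of_bound hg.aestronglyMeasurable B
    (ae_of_all _ fun z => by rw [Real.norm_eq_abs, abs_of_nonneg (hgB z).1]; exact (hgB z).2)
  have hmp : ∀ i, MeasurePreserving (fun D' : Fin n → 𝒵 => D' i) π ν :=
    fun i => measurePreserving_eval (fun _ : Fin n => ν) i
  have hint : ∀ i, Integrable (fun D' : Fin n → 𝒵 => g (D' i)) π :=
    fun i => (hmp i).integrable_comp_of_integrable hgi
  set f : (Fin n → 𝒵) → ℝ := fun D' => s * (∑ i, g (D' i) - c) with hf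
  have hfm : Measurable f := by
    refine Measurable.const_mul (Measurable.sub_const ?_ c) s
    exact Finset.measurable_sum _ fun i _ => hg.comp (measurable_pi_apply i)
  have hfi : Integrable f π :=
    ((integrable_finsetSum _ fun i _ => hint i).sub (integrable_const c)).const_mul s
  have hval : ∫ D', f D' ∂π = s * (n * ∫ z, g z ∂ν - c) := by
    simp only [hf]
    rw [integral_const_mul, integral_sub (integrable_finsetSum _ fun i _ => hint i)
      (integrable_const c), integral_finsetSum _ fun i _ => hint i]
    have : ∀ i, ∫ D', g (D' i) ∂π = ∫ z, g z ∂ν := fun i => by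
      rw [← (hmp i).map_eq, integral_map (hmp i).aemeasurable]
      rw [(hmp i).map_eq]
      exact hg.aestronglyMeasurable
    simp [this]
  have hbd : ∀ D', ‖Real.exp (f D')‖ ≤ Real.exp (|s| * (n * |B| + |c|)) := fun D' => by
    rw [Real.norm_eq_abs, Real.abs_exp, Real.exp_le_exp]
    refine (le_abs_self _).trans ?_
    simp only [hf, abs_mul]
    refine mul_le_mul_of_nonneg_left ((abs_sub _ _).trans (add_le_add_left ?_ _)) (abs_nonneg _)
    refine (Finset.abs_sum_le_sum_abs _ _).trans ?_
    refine (Finset.sum_le_sum (g := fun _ => |B|) fun i _ => ?_).trans (by simp)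
    rw [abs_of_nonneg (hgB _).1]
    exact (hgB _).2.trans (le_abs_self _)
  have hei : Integrable (fun D' => Real.exp (f D')) π :=
    Integrable.of_bound (Real.measurable_exp.comp hfm).aestronglyMeasurable _ (ae_of_all _ hbd)
  rw [← hval, ← ofReal_integral_eq_lintegral_ofReal hei (ae_of_all _ fun _ => (Real.exp_pos _).le)]
  refine ENNReal.ofReal_le_ofReal ?_
  exact convexOn_exp.map_integral_le Real.continuous_exp.continuousOn isClosed_univ
    (ae_of_all _ fun _ => Set.mem_univ _) hfi hei

/-- The deviation inequality: the mean of the selected function `h D` exceeds its average over the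
sample `D` by more than `ε` with exponentially small probability. Only the joint measurability of
`h` is used, since the selected function alone matters. -/
theorem measure_deviation_le {𝒵 𝒲 : Type*} [MeasurableSpace 𝒵] (ν : Measure 𝒵)
    [IsProbabilityMeasure ν] {F : Set (𝒲 → Bool)} {V : ℕ} (hF : vcDim F ≤ V)
    (e : 𝒵 → ℝ → 𝒲) {B : ℝ} (hB : 0 < B) {n : ℕ} (hn : 0 < n) (h : (Fin n → 𝒵) → 𝒵 → ℝ)
    (hmeas : Measurable (Function.uncurry h)) (hhB : ∀ D z, h D z ∈ Set.Icc 0 B)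
    (hhF : ∀ D, ∃ φ ∈ F, ∀ z t, 0 < t → t ≤ B → (φ (e z t) = true ↔ t ≤ h D z))
    {ε : ℝ} (hε : 0 < ε) (hεB : ε ≤ 8 * B) :
    (Measure.pi fun _ : Fin n => ν) {D | (∑ i, h D (D i)) / n + ε < ∫ z, h D z ∂ν} ≤
      ENNReal.ofReal (2 * (32 * B / ε) ^ (2 * V) * Real.exp (-(n * ε ^ 2 / (8 * B ^ 2)))) := by
  set π : Measure (Fin n → 𝒵) := Measure.pi fun _ : Fin n => ν with hπ
  have hn' : (0 : ℝ) < n := by exact_mod_cast hn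
  -- `s` minimizes the resulting exponent `- s n ε / 2 + n s² B² / 2`, where `η` is chosen so
  -- that the covering error contributes `s n ε / 2`.
  set s : ℝ := ε / (2 * B ^ 2) with hs
  set η : ℝ := ε / (8 * B) with hη
  have hs0 : 0 ≤ s := by positivity
  have hη0 : 0 < η := by positivity
  have hη1 : η ≤ 1 := by rw [hη, div_le_one (by positivity)]; exact hεB
  have hmp := (measurePreserving_arrowProdEquivProdArrow 𝒵 𝒵 (Fin n) (fun _ => ν) (fun _ => ν))
  set Q : (Fin n → 𝒵) × (Fin n → 𝒵) → ℝ≥0∞ := fun q =>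
    ENNReal.ofReal (Real.exp (s * ∑ i, (h q.1 (q.2 i) - h q.1 (q.1 i)))) with hQ
  have hQm : Measurable Q := by
    refine (Real.measurable_exp.comp (Measurable.const_mul ?_ s)).ennreal_ofReal
    refine Finset.measurable_sum _ fun i _ => Measurable.sub ?_ ?_
    · exact hmeas.comp (measurable_fst.prodMk ((measurable_pi_apply i).comp measurable_snd))
    · exact hmeas.comp (measurable_fst.prodMk ((measurable_pi_apply i).comp measurable_fst))
  have hghost := lintegral_exp_ghost_le ν hF e hB hn h hmeas hhB hhF hη0 hη1 hs0
  have hfub : ∫⁻ D, ∫⁻ D', Q (D, D') ∂π ∂π ≤ ENNReal.ofReal (2 * (4 / η) ^ (2 * V) *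
      Real.exp (n * (4 * s * B * η) + n * (s ^ 2 * B ^ 2 / 2))) := by
    rw [← lintegral_prod _ hQm.aemeasurable, ← hmp.lintegral_comp hQm]
    exact hghost
  have hjensen : ∀ D, ENNReal.ofReal (Real.exp (s * (n * ∫ z, h D z ∂ν - ∑ i, h D (D i)))) ≤
      ∫⁻ D', Q (D, D') ∂π := fun D => by
    have := exp_integral_le_lintegral_exp (n := n) ν (h D) (hmeas.comp measurable_prodMk_left)
      (hhB D) s (∑ i, h D (D i))
    simpa only [hQ, Finset.sum_sub_distrib] using this
  have hsub : {D | (∑ i, h D (D i)) / n + ε < ∫ z, h D z ∂ν} ⊆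
      {D | ENNReal.ofReal (Real.exp (s * (n * ε))) ≤ ∫⁻ D', Q (D, D') ∂π} := by
    intro D hD
    refine le_trans (ENNReal.ofReal_le_ofReal (Real.exp_le_exp.2 ?_)) (hjensen D)
    refine mul_le_mul_of_nonneg_left ?_ hs0
    have h1 : (∑ i, h D (D i)) / n + ε < ∫ z, h D z ∂ν := hD
    have h2 := mul_lt_mul_of_pos_left h1 hn'
    have h3 : (n : ℝ) * ((∑ i, h D (D i)) / n + ε) = ∑ i, h D (D i) + n * ε := by field_simp
    linarith
  refine (measure_mono hsub).trans ?_
  refine (meas_ge_le_lintegral_div (hQm.lintegral_prod_right').aemeasurable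
    (by simp [Real.exp_pos]) ENNReal.ofReal_ne_top).trans ?_
  refine (ENNReal.div_le_div_right hfub _).trans ?_
  rw [← ENNReal.ofReal_div_of_pos (Real.exp_pos _)]
  refine ENNReal.ofReal_le_ofReal (le_of_eq ?_)
  rw [mul_div_assoc, ← Real.exp_sub]
  have h4 : 4 / η = 32 * B / ε := by rw [hη]; field_simp; norm_num
  rw [h4]
  congr 2
  rw [hs, hη]
  field_simp
  ring

/-! ### Summability of the deviation bounds -/

lemma summable_exp_neg_mul_rpow {a δ : ℝ} (ha : 0 < a) (hδ : 0 < δ) :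
    Summable fun n : ℕ => Real.exp (-a * (n : ℝ) ^ δ) := by
  have h1 := isLittleO_exp_neg_mul_rpow_atTop ha (-2 / δ)
  have h2 : Tendsto (fun n : ℕ => (n : ℝ) ^ δ) atTop atTop :=
    (tendsto_rpow_atTop hδ).comp tendsto_natCast_atTop_atTop
  have h3 := (h1.comp_tendsto h2).isBigO
  have h4 : Summable fun n : ℕ => (n : ℝ) ^ (-2 : ℝ) := Real.summable_nat_rpow.2 (by norm_num)
  refine summable_of_isBigO_nat h4 (h3.trans (Eventually.isBigO ?_))
  refine Eventually.of_forall fun n => ?_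
  simp only [Function.comp_apply]
  rw [← Real.rpow_mul (Nat.cast_nonneg n), mul_div_cancel₀ _ hδ.ne', Real.norm_eq_abs,
    abs_of_nonneg (by positivity)]

lemma summable_deviation_bound {b : ℕ → ℝ} (hb : Tendsto b atTop atTop) {V : ℕ → ℕ}
    (hrate : Tendsto (fun n : ℕ => (V n : ℝ) * b n ^ 2 * Real.log (b n) / (n : ℝ)) atTop (𝓝 0))
    {δ : ℝ} (hδ : 0 < δ)
    (hgrowth : Tendsto (fun n : ℕ => (n : ℝ) ^ (1 - δ) / b n ^ 2) atTop atTop)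
    {YL : ℝ} (hYL : 0 < YL) {ε : ℝ} (hε : 0 < ε) :
    Summable fun n : ℕ => 2 * (32 * (1 + b n / YL) / ε) ^ (2 * V n) *
      Real.exp (-(n * ε ^ 2 / (8 * (1 + b n / YL) ^ 2))) := by
  set C : ℝ := 1 + 1 / YL with hC
  have hCpos : 0 < C := by positivity
  set c : ℝ := ε ^ 2 / (8 * C ^ 2) with hc
  have hcpos : 0 < c := by positivity
  refine Summable.of_norm_bounded_eventually_nat
    ((summable_exp_neg_mul_rpow (half_pos hcpos) hδ).mul_left 2) ?_
  filter_upwards [hb.eventually_ge_atTop 1, hb.eventually_ge_atTop (32 * C / ε),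
    hrate.eventually_le_const (by positivity : (0 : ℝ) < c / 8), hgrowth.eventually_ge_atTop 1,
    eventually_ge_atTop 1] with n hb1 hb2 hr hg hn
  have hn' : (0 : ℝ) < n := by exact_mod_cast hn
  have hbpos : 0 < b n := by linarith
  have hB1 : 1 + b n / YL ≤ C * b n := by
    rw [hC, add_mul, one_mul, one_div, inv_mul_eq_div]; linarith
  have hBpos : 0 < 1 + b n / YL := by positivity
  have hbase : 32 * (1 + b n / YL) / ε ≤ b n ^ 2 := by
    calc 32 * (1 + b n / YL) / ε ≤ 32 * (C * b n) / ε := by gcongr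
      _ = (32 * C / ε) * b n := by ring
      _ ≤ b n * b n := by gcongr
      _ = b n ^ 2 := by ring
  have hpow : (32 * (1 + b n / YL) / ε) ^ (2 * V n) ≤ Real.exp (4 * V n * Real.log (b n)) := by
    calc (32 * (1 + b n / YL) / ε) ^ (2 * V n) ≤ (b n ^ 2) ^ (2 * V n) := by gcongr
      _ = (Real.exp (Real.log (b n)) ^ 2) ^ (2 * V n) := by rw [Real.exp_log hbpos]
      _ = Real.exp (4 * V n * Real.log (b n)) := by
        rw [← pow_mul, ← Real.exp_nat_mul]; push_cast; ring_nf
  have hexp : c * (n / b n ^ 2) ≤ n * ε ^ 2 / (8 * (1 + b n / YL) ^ 2) := by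
    calc c * (n / b n ^ 2) = n * ε ^ 2 / (8 * (C * b n) ^ 2) := by rw [hc]; field_simp
      _ ≤ _ := by gcongr
  have hV : 4 * V n * Real.log (b n) ≤ c / 2 * (n / b n ^ 2) := by
    rw [div_le_iff₀ hn'] at hr
    rw [← mul_div_assoc, le_div_iff₀ (by positivity)]
    nlinarith
  have hδn : (n : ℝ) ^ δ ≤ n / b n ^ 2 := by
    rw [le_div_iff₀ (by positivity)] at hg ⊢
    have : (n : ℝ) = (n : ℝ) ^ δ * (n : ℝ) ^ (1 - δ) := by
      rw [← Real.rpow_add hn']; simp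
    calc (n : ℝ) ^ δ * b n ^ 2 ≤ (n : ℝ) ^ δ * (n : ℝ) ^ (1 - δ) := by gcongr; linarith
      _ = n := this.symm
  rw [Real.norm_eq_abs, abs_of_nonneg (by positivity)]
  calc 2 * (32 * (1 + b n / YL) / ε) ^ (2 * V n) *
        Real.exp (-(n * ε ^ 2 / (8 * (1 + b n / YL) ^ 2)))
      ≤ 2 * Real.exp (4 * V n * Real.log (b n)) * Real.exp (-(c * (n / b n ^ 2))) := by gcongr
    _ = 2 * Real.exp (4 * V n * Real.log (b n) - c * (n / b n ^ 2)) := by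
        rw [mul_assoc, ← Real.exp_add, sub_eq_add_neg]
    _ ≤ 2 * Real.exp (-(c / 2) * (n : ℝ) ^ δ) := by
        gcongr
        nlinarith

/-! ### Approximation of the optimal risk -/

lemma DenseInL1.exists_lintegral_lt {d : ℕ} {S : Set (Input d → ℝ)} {μ : Measure (Input d)}
    (hS : DenseInL1 S μ) {f : Input d → ℝ} (hf : Integrable f μ) {ε : ℝ} (hε : 0 < ε) :
    ∃ g ∈ S, ∫⁻ x, ‖g x - f x‖ₑ ∂μ < ENNReal.ofReal ε := by
  obtain ⟨h, ⟨g, hgS, hg⟩, hdist⟩ := Dense.exists_dist_lt hS (hf.toL1 f) hε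
  refine ⟨g, hgS, ?_⟩
  have h1 : edist (hf.toL1 f) h < ENNReal.ofReal ε := by
    rw [edist_dist]; exact (ENNReal.ofReal_lt_ofReal_iff hε).2 hdist
  rw [L1.edist_def] at h1
  refine lt_of_eq_of_lt (lintegral_congr_ae ?_) h1
  filter_upwards [hg, hf.coeFn_toL1] with x hx hx'
  rw [edist_comm, edist_eq_enorm_sub, hx, hx']

lemma mapeLoss_of_ne_zero {p y : ℝ} (hy : y ≠ 0) :
    mapeLoss p y = ENNReal.ofReal (1 / |y|) * ‖p - y‖ₑ := by
  rw [mapeLoss, if_neg hy, Real.enorm_eq_ofReal_abs, ← ENNReal.ofReal_mul (by positivity)]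
  ring_nf

lemma exists_risk_lt {d : ℕ} (ν : Measure (Input d × ℝ)) [IsProbabilityMeasure ν] {YL : ℝ}
    (hYL : 0 < YL) (hν : ∀ᵐ z ∂ν, YL ≤ |z.2|) {S : Set (Input d → ℝ)}
    (hSm : ∀ g ∈ S, Measurable g)
    (hS : ∀ μ : Measure (Input d), IsProbabilityMeasure μ → DenseInL1 S μ) {ε : ℝ} (hε : 0 < ε) :
    ∃ g ∈ S, risk mapeLoss ν g < optimalRisk mapeLoss ν + ENNReal.ofReal ε := by
  have hw : Measurable fun z : Input d × ℝ => ENNReal.ofReal (1 / |z.2|) := by fun_prop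
  -- The absolute percentage error is an absolute error under the measure `ρ` of density `1 / |y|`.
  set ρ : Measure (Input d × ℝ) := ν.withDensity fun z => ENNReal.ofReal (1 / |z.2|) with hρ
  have hrisk : ∀ g : Input d → ℝ, Measurable g →
      risk mapeLoss ν g = ∫⁻ z, ‖g z.1 - z.2‖ₑ ∂ρ := fun g hg => by
    rw [hρ, lintegral_withDensity_eq_lintegral_mul _ hw (by fun_prop), risk]
    refine lintegral_congr_ae ?_
    filter_upwards [hν] with z hz
    have hz0 : z.2 ≠ 0 := fun h => by rw [h, abs_zero] at hz; linarith
    exact mapeLoss_of_ne_zero hz0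
  have hzero : risk mapeLoss ν (fun _ => 0) = 1 := by
    have : ∀ᵐ z ∂ν, mapeLoss 0 z.2 = 1 := by
      filter_upwards [hν] with z hz
      have hz0 : z.2 ≠ 0 := fun h => by rw [h, abs_zero] at hz; linarith
      simp [mapeLoss, hz0]
    rw [risk, lintegral_congr_ae this]
    simp
  have hopt : optimalRisk mapeLoss ν ≠ ∞ := by
    refine ne_top_of_le_ne_top ENNReal.one_ne_top ?_
    rw [← hzero]
    exact iInf₂_le _ measurable_const
  have hρfin : ρ Set.univ ≠ ∞ := by
    rw [hρ, withDensity_apply _ MeasurableSet.univ, Measure.restrict_univ]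
    refine ne_top_of_le_ne_top (ENNReal.ofReal_ne_top (r := 1 / YL)) ?_
    calc ∫⁻ z, ENNReal.ofReal (1 / |z.2|) ∂ν ≤ ∫⁻ _z, ENNReal.ofReal (1 / YL) ∂ν := by
          refine lintegral_mono_ae ?_
          filter_upwards [hν] with z hz
          gcongr
      _ = _ := by simp
  have hρ0 : ρ Set.univ ≠ 0 := by
    rw [hρ, withDensity_apply _ MeasurableSet.univ, Measure.restrict_univ]
    intro h0
    rw [lintegral_eq_zero_iff hw] at h0
    have hf : ∀ᵐ z ∂ν, False := by
      filter_upwards [h0, hν] with z hz hz'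
      have hpos : 0 < |z.2| := by linarith
      have : 0 < 1 / |z.2| := by positivity
      exact absurd hz (ENNReal.ofReal_pos.2 this).ne'
    obtain ⟨_, h⟩ := hf.exists
    exact h
  set μ₀ : Measure (Input d) := ρ.map Prod.fst with hμ₀
  have hμ₀u : μ₀ Set.univ = ρ Set.univ := by
    rw [hμ₀, Measure.map_apply measurable_fst MeasurableSet.univ, Set.preimage_univ]
  set μ : Measure (Input d) := (ρ Set.univ)⁻¹ • μ₀ with hμ
  have hμprob : IsProbabilityMeasure μ :=
    ⟨by rw [hμ, Measure.smul_apply, hμ₀u, smul_eq_mul, ENNReal.inv_mul_cancel hρ0 hρfin]⟩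
  have hμint : ∀ f : Input d → ℝ≥0∞, Measurable f →
      ∫⁻ x, f x ∂μ = (ρ Set.univ)⁻¹ * ∫⁻ z, f z.1 ∂ρ := fun f hf => by
    rw [hμ, lintegral_smul_measure, hμ₀, lintegral_map hf measurable_fst, smul_eq_mul]
  obtain ⟨g, hg, hgrisk⟩ : ∃ g : Input d → ℝ, Measurable g ∧
      risk mapeLoss ν g < optimalRisk mapeLoss ν + ENNReal.ofReal (ε / 2) := by
    have : optimalRisk mapeLoss ν < optimalRisk mapeLoss ν + ENNReal.ofReal (ε / 2) :=
      ENNReal.lt_add_right hopt (by simpa using hε)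
    conv_lhs at this => rw [optimalRisk]
    simpa only [iInf_lt_iff, exists_prop] using this
  have hgint : Integrable g μ := by
    refine ⟨hg.aestronglyMeasurable, ?_⟩
    rw [hasFiniteIntegral_iff_enorm, hμint _ hg.enorm]
    refine ENNReal.mul_lt_top (ENNReal.inv_lt_top.2 (pos_iff_ne_zero.2 hρ0)) ?_
    calc ∫⁻ z, ‖g z.1‖ₑ ∂ρ ≤ ∫⁻ z, (‖g z.1 - z.2‖ₑ + ‖(0 : ℝ) - z.2‖ₑ) ∂ρ := by
          refine lintegral_mono fun z => ?_
          calc ‖g z.1‖ₑ = ‖(g z.1 - z.2) - (0 - z.2)‖ₑ := by ring_nf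
            _ ≤ _ := enorm_sub_le
      _ = risk mapeLoss ν g + risk mapeLoss ν (fun _ => 0) := by
          rw [hrisk g hg, hrisk _ measurable_const, lintegral_add_left (by fun_prop)]
      _ < ∞ := by
          rw [hzero]
          exact ENNReal.add_lt_top.2 ⟨hgrisk.trans_le le_top, ENNReal.one_lt_top⟩
  have hm : 0 < (ρ Set.univ).toReal := ENNReal.toReal_pos hρ0 hρfin
  obtain ⟨g', hg'S, hg'⟩ := (hS μ hμprob).exists_lintegral_lt hgint
    (ε := ε / 2 / (ρ Set.univ).toReal) (by positivity)
  have hg'm := hSm g' hg'S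
  refine ⟨g', hg'S, ?_⟩
  have hdist : ∫⁻ z, ‖g' z.1 - g z.1‖ₑ ∂ρ ≤ ENNReal.ofReal (ε / 2) := by
    rw [hμint (fun x => ‖g' x - g x‖ₑ) (by fun_prop), ENNReal.ofReal_div_of_pos hm,
      ENNReal.ofReal_toReal hρfin, mul_comm, ← div_eq_mul_inv] at hg'
    exact ((ENNReal.div_lt_div_iff_left hρ0 hρfin).1 hg').le
  calc risk mapeLoss ν g' = ∫⁻ z, ‖g' z.1 - z.2‖ₑ ∂ρ := hrisk g' hg'm
    _ ≤ ∫⁻ z, (‖g z.1 - z.2‖ₑ + ‖g' z.1 - g z.1‖ₑ) ∂ρ := by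
        refine lintegral_mono fun z => ?_
        calc ‖g' z.1 - z.2‖ₑ = ‖(g z.1 - z.2) + (g' z.1 - g z.1)‖ₑ := by ring_nf
          _ ≤ _ := enorm_add_le _ _
    _ = risk mapeLoss ν g + ∫⁻ z, ‖g' z.1 - g z.1‖ₑ ∂ρ := by
        rw [hrisk g hg, lintegral_add_left (by fun_prop)]
    _ < optimalRisk mapeLoss ν + ENNReal.ofReal (ε / 2) + ENNReal.ofReal (ε / 2) :=
        ENNReal.add_lt_add_of_lt_of_le (ne_top_of_le_ne_top ENNReal.ofReal_ne_top hdist)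
          hgrisk hdist
    _ = optimalRisk mapeLoss ν + ENNReal.ofReal ε := by
        rw [add_assoc, ← ENNReal.ofReal_add (by positivity) (by positivity), add_halves]

lemma enorm_le_classNorm {d : ℕ} {G : Set (Input d → ℝ)} {g : Input d → ℝ} (hg : g ∈ G)
    (x : Input d) : ‖g x‖ₑ ≤ classNorm G :=
  (le_iSup (fun x => ‖g x‖ₑ) x).trans (le_iSup₂ (f := fun g (_ : g ∈ G) => ⨆ x, ‖g x‖ₑ) g hg)

lemma abs_le_classNorm {d : ℕ} {G : Set (Input d → ℝ)} (hG : classNorm G < ∞) {g : Input d → ℝ}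
    (hg : g ∈ G) (x : Input d) : |g x| ≤ (classNorm G).toReal := by
  have h := ENNReal.toReal_mono hG.ne (enorm_le_classNorm hg x)
  simpa using h

lemma subset_of_le {d : ℕ} {G : ℕ → Set (Input d → ℝ)}
    (hGmono : ∀ n, 1 ≤ n → G n ⊆ G (n + 1)) {m n : ℕ} (hm : 1 ≤ m) (hmn : m ≤ n) :
    G m ⊆ G n := by
  induction n, hmn using Nat.le_induction with
  | base => exact subset_rfl
  | succ k hk ih => exact ih.trans (hGmono k (hm.trans hk))

/-- Density in `L¹` of a point mass already forces the uniform bounds of the classes to diverge. -/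
lemma tendsto_classNorm {d : ℕ} {G : ℕ → Set (Input d → ℝ)}
    (hGmono : ∀ n, 1 ≤ n → G n ⊆ G (n + 1))
    (hGdense : ∀ μ : Measure (Input d), IsProbabilityMeasure μ → DenseInL1 (⋃ n ≥ 1, G n) μ)
    (hGnorm : ∀ n, 1 ≤ n → classNorm (G n) < ∞) :
    Tendsto (fun n => (classNorm (G n)).toReal) atTop atTop := by
  refine tendsto_atTop.2 fun R => ?_
  obtain ⟨g, hg, hgd⟩ := (hGdense (Measure.dirac 0) inferInstance).exists_lintegral_lt
    (integrable_const (R + 1)) one_pos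
  rw [lintegral_dirac, Real.enorm_eq_ofReal_abs, ENNReal.ofReal_lt_ofReal_iff one_pos] at hgd
  simp only [Set.mem_iUnion, exists_prop] at hg
  obtain ⟨m, hm, hgm⟩ := hg
  filter_upwards [eventually_ge_atTop m] with n hn
  have h1 := abs_le_classNorm (hGnorm n (le_trans hm hn)) (subset_of_le hGmono hm hn hgm) 0
  linarith [(abs_lt.1 hgd).1, le_abs_self (g 0)]

/-! ### The clipped loss -/

/-- The loss of the model `g` at the observation `z`, clipped at `B` to make it real-valued
everywhere, including at the observations with `z.2 = 0`. -/
noncomputable def clippedLoss {d : ℕ} (B : ℝ) (g : Input d → ℝ) (z : Input d × ℝ) : ℝ :=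
  (min (mapeLoss (g z.1) z.2) (ENNReal.ofReal B)).toReal

lemma clippedLoss_mem_Icc {d : ℕ} {B : ℝ} (hB : 0 ≤ B) (g : Input d → ℝ) (z : Input d × ℝ) :
    clippedLoss B g z ∈ Set.Icc 0 B :=
  ⟨ENNReal.toReal_nonneg, ENNReal.toReal_le_of_le_ofReal hB (min_le_right _ _)⟩

lemma clippedLoss_nonneg {d : ℕ} (B : ℝ) (g : Input d → ℝ) (z : Input d × ℝ) :
    0 ≤ clippedLoss B g z :=
  ENNReal.toReal_nonneg

lemma ofReal_clippedLoss {d : ℕ} {B : ℝ} {g : Input d → ℝ} {z : Input d × ℝ}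
    (h : mapeLoss (g z.1) z.2 ≤ ENNReal.ofReal B) :
    ENNReal.ofReal (clippedLoss B g z) = mapeLoss (g z.1) z.2 := by
  rw [clippedLoss, min_eq_left h, ENNReal.ofReal_toReal (ne_top_of_le_ne_top (by simp) h)]

lemma le_clippedLoss_iff {d : ℕ} {B : ℝ} (g : Input d → ℝ) (z : Input d × ℝ) {t : ℝ}
    (ht : 0 < t) (htB : t ≤ B) :
    t ≤ clippedLoss B g z ↔ (t : EReal) ≤ ((mapeLoss (g z.1) z.2 : ℝ≥0∞) : EReal) := by
  have hne : min (mapeLoss (g z.1) z.2) (ENNReal.ofReal B) ≠ ∞ :=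
    ne_top_of_le_ne_top ENNReal.ofReal_ne_top (min_le_right _ _)
  rw [clippedLoss, ← ENNReal.ofReal_le_iff_le_toReal hne, le_min_iff,
    and_iff_left (ENNReal.ofReal_le_ofReal htB), ← EReal.coe_ennreal_le_coe_ennreal_iff,
    EReal.coe_ennreal_ofReal, max_eq_left ht.le]

lemma measurable_mapeLoss : Measurable fun q : ℝ × ℝ => mapeLoss q.1 q.2 := by
  refine Measurable.ite (measurable_snd (measurableSet_singleton 0)) ?_ (by fun_prop)
  exact Measurable.ite (measurable_fst (measurableSet_singleton 0)) measurable_const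
    measurable_const

lemma mapeLoss_le {YL b p y : ℝ} (hYL : 0 < YL) (hy : YL ≤ |y|) (hp : |p| ≤ b) :
    mapeLoss p y ≤ ENNReal.ofReal (1 + b / YL) := by
  have hy0 : y ≠ 0 := fun h => by rw [h, abs_zero] at hy; linarith
  rw [mapeLoss, if_neg hy0]
  refine ENNReal.ofReal_le_ofReal ?_
  have hb : 0 ≤ b := (abs_nonneg p).trans hp
  have hya : 0 < |y| := abs_pos.2 hy0
  rw [div_le_iff₀ hya]
  have h1 : |p - y| ≤ |p| + |y| := abs_sub _ _
  have h2 : b ≤ b / YL * |y| := by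
    rw [div_mul_eq_mul_div, le_div_iff₀ hYL]; gcongr
  linarith

lemma empiricalRisk_eq {d n : ℕ} (hn : 0 < n) {B : ℝ} {g : Input d → ℝ}
    {D : Fin n → Input d × ℝ}
    (h : ∀ i, mapeLoss (g (D i).1) (D i).2 ≤ ENNReal.ofReal B) :
    empiricalRisk mapeLoss D g = ENNReal.ofReal ((∑ i, clippedLoss B g (D i)) / n) := by
  have hn' : (0 : ℝ) < n := by exact_mod_cast hn
  rw [empiricalRisk, ENNReal.ofReal_div_of_pos hn', ENNReal.ofReal_natCast,
    ENNReal.ofReal_sum_of_nonneg fun i _ => clippedLoss_nonneg B g (D i)]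
  congr 1
  exact Finset.sum_congr rfl fun i _ => (ofReal_clippedLoss (h i)).symm

lemma measurable_clippedLoss {d : ℕ} (B : ℝ) {α : Type*} [MeasurableSpace α]
    {f : α × Input d → ℝ} (hf : Measurable f) :
    Measurable fun q : α × (Input d × ℝ) => clippedLoss B (fun x => f (q.1, x)) q.2 := by
  refine Measurable.ennreal_toReal (Measurable.min ?_ measurable_const)
  exact measurable_mapeLoss.comp ((hf.comp (measurable_fst.prodMk measurable_snd.fst)).prodMk
    measurable_snd.snd)

lemma measurable_clippedLoss_of_measurable {d : ℕ} (B : ℝ) {g : Input d → ℝ}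
    (hg : Measurable g) : Measurable (clippedLoss B g) :=
  ((measurable_mapeLoss.comp ((hg.comp measurable_fst).prodMk measurable_snd)).min
    measurable_const).ennreal_toReal

lemma integrable_clippedLoss {d : ℕ} {ν : Measure (Input d × ℝ)} [IsProbabilityMeasure ν]
    {B : ℝ} (hB : 0 ≤ B) {g : Input d → ℝ} (hg : Measurable g) :
    Integrable (clippedLoss B g) ν := by
  refine Integrable.of_bound (measurable_clippedLoss_of_measurable B hg).aestronglyMeasurable B
    (ae_of_all _ fun z => ?_)
  have h := clippedLoss_mem_Icc hB g z
  rw [Real.norm_eq_abs, abs_of_nonneg h.1]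
  exact h.2

lemma risk_eq {d : ℕ} {ν : Measure (Input d × ℝ)} [IsProbabilityMeasure ν] {B : ℝ} (hB : 0 ≤ B)
    {g : Input d → ℝ} (hg : Measurable g)
    (h : ∀ᵐ z ∂ν, mapeLoss (g z.1) z.2 ≤ ENNReal.ofReal B) :
    risk mapeLoss ν g = ENNReal.ofReal (∫ z, clippedLoss B g z ∂ν) := by
  rw [ofReal_integral_eq_lintegral_ofReal (integrable_clippedLoss hB hg)
    (ae_of_all _ (clippedLoss_nonneg B g)), risk]
  refine lintegral_congr_ae ?_
  filter_upwards [h] with z hz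
  exact (ofReal_clippedLoss hz).symm

/-! ### Laws of large numbers -/

section Sample

variable {d : ℕ} {Ω : Type*} [MeasurableSpace Ω] {P : Measure Ω}
  {ν : Measure (Input d × ℝ)} {Zs : ℕ → Ω → Input d × ℝ} {YL : ℝ}

lemma map_sample_eq_pi [IsProbabilityMeasure P] (hZmeas : ∀ i, Measurable (Zs i)) (hZindep : iIndepFun Zs P)
    (hlaw : ∀ i, P.map (Zs i) = ν) (n : ℕ) :
    P.map (fun ω (i : Fin n) => Zs i ω) = Measure.pi fun _ : Fin n => ν := by
  have h := (iIndepFun_iff_map_fun_eq_pi_map (f := fun i : Fin n => Zs i)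
    (fun i => (hZmeas i).aemeasurable)).1 (hZindep.precomp Fin.val_injective)
  rw [h]
  simp only [hlaw]

lemma ae_forall_le_abs (hZmeas : ∀ i, Measurable (Zs i)) (hlaw : ∀ i, P.map (Zs i) = ν)
    (hν : ∀ᵐ z ∂ν, YL ≤ |z.2|) : ∀ᵐ ω ∂P, ∀ i, YL ≤ |(Zs i ω).2| := by
  rw [ae_all_iff]
  intro i
  rw [← hlaw i] at hν
  exact ae_of_ae_map (hZmeas i).aemeasurable hν

/-- The strong law of large numbers for the empirical risk of a fixed bounded model. -/
lemma ae_tendsto_empiricalRisk [IsProbabilityMeasure ν]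
    (hZmeas : ∀ i, Measurable (Zs i)) (hZindep : iIndepFun Zs P)
    (hlaw : ∀ i, P.map (Zs i) = ν) (hYL : 0 < YL) (hν : ∀ᵐ z ∂ν, YL ≤ |z.2|)
    {g : Input d → ℝ} (hg : Measurable g) {b : ℝ} (hb : 0 ≤ b) (hgb : ∀ x, |g x| ≤ b) :
    ∀ᵐ ω ∂P, Tendsto (fun n : ℕ => empiricalRisk mapeLoss (fun i : Fin n => Zs i ω) g) atTop
      (𝓝 (risk mapeLoss ν g)) := by
  set B : ℝ := 1 + b / YL with hB
  have hB0 : 0 ≤ B := by positivity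
  have hξ := measurable_clippedLoss_of_measurable B hg
  have hident : ∀ i, IdentDistrib (Zs i) (Zs 0) P P := fun i =>
    ⟨(hZmeas i).aemeasurable, (hZmeas 0).aemeasurable, by rw [hlaw, hlaw]⟩
  have hint : Integrable (fun ω => clippedLoss B g (Zs 0 ω)) P := by
    refine Integrable.comp_measurable (g := clippedLoss B g) ?_ (hZmeas 0)
    rw [hlaw]
    exact integrable_clippedLoss hB0 hg
  have hslln := strong_law_ae_real (fun i ω => clippedLoss B g (Zs i ω)) hint
    (fun i j hij => (hZindep.indepFun hij).comp hξ hξ)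
    (fun i => (hident i).comp hξ)
  have hmean : ∫ ω, clippedLoss B g (Zs 0 ω) ∂P = ∫ z, clippedLoss B g z ∂ν := by
    rw [← hlaw 0, integral_map (hZmeas 0).aemeasurable hξ.aestronglyMeasurable]
  have hrisk := risk_eq (ν := ν) hB0 hg (hν.mono fun z hz => mapeLoss_le hYL hz (hgb z.1))
  filter_upwards [hslln, ae_forall_le_abs hZmeas hlaw hν] with ω hω hY
  rw [hmean] at hω
  rw [hrisk]
  refine (ENNReal.tendsto_ofReal hω).congr' ?_
  filter_upwards [eventually_gt_atTop 0] with n hn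
  rw [empiricalRisk_eq hn fun i => mapeLoss_le hYL (hY i) (hgb _), Finset.sum_range]

/-- The risk of the selected model is almost surely eventually at most its empirical risk
plus `ε`. -/
lemma ae_eventually_risk_le [IsProbabilityMeasure P] [IsProbabilityMeasure ν]
    (hZmeas : ∀ i, Measurable (Zs i)) (hZindep : iIndepFun Zs P)
    (hlaw : ∀ i, P.map (Zs i) = ν) (hYL : 0 < YL) (hν : ∀ᵐ z ∂ν, YL ≤ |z.2|)
    {G : ℕ → Set (Input d → ℝ)} (hGmeas : ∀ n, 1 ≤ n → ∀ g ∈ G n, Measurable g)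
    {V : ℕ → ℕ} (hV : ∀ n, 1 ≤ n → vcDim (Hplus (G n) mapeLoss) ≤ V n)
    {b : ℕ → ℝ} (hb0 : ∀ n, 0 ≤ b n) (hGb : ∀ n, 1 ≤ n → ∀ g ∈ G n, ∀ x, |g x| ≤ b n)
    (ghat : (n : ℕ) → (Fin n → Input d × ℝ) → Input d → ℝ)
    (hghat_meas : ∀ n, 1 ≤ n →
      Measurable (fun p : (Fin n → Input d × ℝ) × Input d => ghat n p.1 p.2))
    (hghat_mem : ∀ n, 1 ≤ n → ∀ D, ghat n D ∈ G n) {ε : ℝ} (hε : 0 < ε) (hε1 : ε ≤ 1)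
    (hsum : Summable fun n : ℕ => 2 * (32 * (1 + b n / YL) / ε) ^ (2 * V n) *
      Real.exp (-(n * ε ^ 2 / (8 * (1 + b n / YL) ^ 2)))) :
    ∀ᵐ ω ∂P, ∀ᶠ n : ℕ in atTop,
      risk mapeLoss ν (ghat n (fun i : Fin n => Zs i ω)) ≤
        empiricalRisk mapeLoss (fun i : Fin n => Zs i ω) (ghat n (fun i : Fin n => Zs i ω)) +
          ENNReal.ofReal ε := by
  classical
  set B : ℕ → ℝ := fun n => 1 + b n / YL with hB
  have hB1 : ∀ n, 1 ≤ B n := fun n => by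
    have : 0 ≤ b n / YL := div_nonneg (hb0 n) hYL.le
    simp only [hB]; linarith
  set bad : (n : ℕ) → Set (Fin n → Input d × ℝ) := fun n =>
    {D | (∑ i, clippedLoss (B n) (ghat n D) (D i)) / n + ε <
      ∫ z, clippedLoss (B n) (ghat n D) z ∂ν} with hbad
  have hdev : ∀ n, 1 ≤ n → P {ω | (fun i : Fin n => Zs i ω) ∈ bad n} ≤
      ENNReal.ofReal (2 * (32 * B n / ε) ^ (2 * V n) *
        Real.exp (-(n * ε ^ 2 / (8 * B n ^ 2)))) := fun n hn => by
    have hmap := map_sample_eq_pi hZmeas hZindep hlaw n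
    have hm : Measurable fun ω (i : Fin n) => Zs i ω :=
      measurable_pi_lambda _ fun i => hZmeas i
    have hh := measurable_clippedLoss (B n) (hghat_meas n hn)
    refine le_trans ?_ (measure_deviation_le ν (hV n hn)
      (fun (z : Input d × ℝ) t => (z.1, z.2, t)) (zero_lt_one.trans_le (hB1 n)) hn
      (fun D z => clippedLoss (B n) (ghat n D) z) hh
      (fun D z => clippedLoss_mem_Icc (zero_le_one.trans (hB1 n)) _ z) (fun D => ?_) hε
      (by linarith [hB1 n]))
    · rw [← hmap]
      exact Measure.le_map_apply hm.aemeasurable _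
    · refine ⟨_, ⟨ghat n D, hghat_mem n hn D, rfl⟩, fun z t ht htB => ?_⟩
      rw [le_clippedLoss_iff _ _ ht htB]
      simp
  have hbc : ∀ᵐ ω ∂P, ∀ᶠ n : ℕ in atTop,
      ω ∉ {ω | 1 ≤ n ∧ (fun i : Fin n => Zs i ω) ∈ bad n} := by
    refine ae_eventually_notMem (ne_top_of_le_ne_top hsum.tsum_ofReal_ne_top
      (ENNReal.tsum_le_tsum fun n => ?_))
    by_cases hn : 1 ≤ n
    · simp only [hn, true_and]
      exact hdev n hn
    · simp [hn]
  filter_upwards [hbc, ae_forall_le_abs hZmeas hlaw hν] with ω hω hY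
  filter_upwards [hω, eventually_ge_atTop 1] with n hn hn1
  have hmem := hghat_mem n hn1 fun i : Fin n => Zs i ω
  generalize hDdef : (fun i : Fin n => Zs i ω) = D at hmem hn ⊢
  have hg := hGmeas n hn1 _ hmem
  have hgb := hGb n hn1 _ hmem
  have hle : ∫ z, clippedLoss (B n) (ghat n D) z ∂ν ≤
      (∑ i, clippedLoss (B n) (ghat n D) (D i)) / n + ε := by
    by_contra! hcon
    exact hn ⟨hn1, hcon⟩
  have hDY : ∀ i, YL ≤ |(D i).2| := fun i => by rw [← hDdef]; exact hY i
  rw [risk_eq (zero_le_one.trans (hB1 n)) hg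
      (hν.mono fun z hz => mapeLoss_le hYL hz (hgb z.1)),
    empiricalRisk_eq (B := B n) hn1 fun i => mapeLoss_le hYL (hDY i) (hgb _),
    ← ENNReal.ofReal_add (div_nonneg (Finset.sum_nonneg fun i _ => clippedLoss_nonneg _ _ (D i))
      (Nat.cast_nonneg n)) hε.le]
  exact ENNReal.ofReal_le_ofReal hle

end Sample

end MAPE

/-! ### Consistency of empirical risk minimization -/

/- `Zs i` is the observation of index `i + 1`, so the data set `D_n` consists of
`Zs 0, …, Zs (n - 1)`; the classes `G n`, `n ≥ 1`, are indexed as usual. -/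
theorem theorem1 {d : ℕ} {Ω : Type*} [MeasurableSpace Ω] (P : Measure Ω) [IsProbabilityMeasure P]
    -- the random pair `(X, Y)`, with `|Y|` bounded away from zero
    (X : Ω → MAPE.Input d) (Y : Ω → ℝ) (hX : Measurable X) (hY : Measurable Y)
    (YL : ℝ) (hYL : 0 < YL) (hYbound : ∀ᵐ ω ∂P, YL ≤ |Y ω|)
    -- independent copies of the pair
    (Zs : ℕ → Ω → MAPE.Input d × ℝ) (hZmeas : ∀ i, Measurable (Zs i))
    (hZindep : iIndepFun Zs P)
    (hZident : ∀ i, IdentDistrib (Zs i) (fun ω => (X ω, Y ω)) P P)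
    -- the classes of models
    (G : ℕ → Set (MAPE.Input d → ℝ))
    (hGmeas : ∀ n, 1 ≤ n → ∀ g ∈ G n, Measurable g)
    (hGmono : ∀ n, 1 ≤ n → G n ⊆ G (n + 1))
    (hGdense : ∀ μ : Measure (MAPE.Input d), IsProbabilityMeasure μ →
      MAPE.DenseInL1 (⋃ n ≥ 1, G n) μ)
    (V : ℕ → ℕ)
    (hV : ∀ n, 1 ≤ n → MAPE.vcDim (MAPE.Hplus (G n) MAPE.mapeLoss) = (V n : ℕ∞))
    (hGnorm : ∀ n, 1 ≤ n → MAPE.classNorm (G n) < ∞)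
    (hrate : Tendsto (fun n : ℕ => (V n : ℝ) * (MAPE.classNorm (G n)).toReal ^ 2 *
      Real.log (MAPE.classNorm (G n)).toReal / (n : ℝ)) atTop (𝓝 0))
    (δ : ℝ) (hδ : 0 < δ)
    (hgrowth : Tendsto (fun n : ℕ => (n : ℝ) ^ (1 - δ) / (MAPE.classNorm (G n)).toReal ^ 2)
      atTop atTop)
    -- the estimator: a measurable function of the data and of the input point, with values in
    -- `G n`, that almost surely minimizes the empirical risk
    (ghat : (n : ℕ) → (Fin n → MAPE.Input d × ℝ) → MAPE.Input d → ℝ)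
    (hghat_meas : ∀ n, 1 ≤ n →
      Measurable (fun p : (Fin n → MAPE.Input d × ℝ) × MAPE.Input d => ghat n p.1 p.2))
    (hghat_mem : ∀ n, 1 ≤ n → ∀ D, ghat n D ∈ G n)
    (hghat_erm : ∀ n, 1 ≤ n → ∀ᵐ ω ∂P,
      MAPE.IsERM MAPE.mapeLoss (G n) (fun i : Fin n => Zs i ω)
        (ghat n (fun i : Fin n => Zs i ω))) :
    ∀ᵐ ω ∂P, Tendsto
      (fun n : ℕ => MAPE.risk MAPE.mapeLoss (P.map (fun ω' => (X ω', Y ω')))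
        (ghat n (fun i : Fin n => Zs i ω)))
      atTop (𝓝 (MAPE.optimalRisk MAPE.mapeLoss (P.map (fun ω' => (X ω', Y ω'))))) := by
  have hpair : Measurable fun ω => (X ω, Y ω) := hX.prodMk hY
  set ν : Measure (MAPE.Input d × ℝ) := P.map fun ω => (X ω, Y ω) with hνdef
  have hνprob : IsProbabilityMeasure ν := Measure.isProbabilityMeasure_map hpair.aemeasurable
  have hlaw : ∀ i, P.map (Zs i) = ν := fun i => (hZident i).map_eq
  have hν : ∀ᵐ z ∂ν, YL ≤ |z.2| := by
    rw [hνdef, ae_map_iff hpair.aemeasurable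
      (measurableSet_le measurable_const measurable_snd.abs)]
    exact hYbound
  set b : ℕ → ℝ := fun n => (MAPE.classNorm (G n)).toReal with hb
  have hb0 : ∀ n, 0 ≤ b n := fun n => ENNReal.toReal_nonneg
  have hGb : ∀ n, 1 ≤ n → ∀ g ∈ G n, ∀ x, |g x| ≤ b n := fun n hn g hg x =>
    MAPE.abs_le_classNorm (hGnorm n hn) hg x
  have hbtop : Tendsto b atTop atTop := MAPE.tendsto_classNorm hGmono hGdense hGnorm
  -- The tolerances `ε k` serve both in the deviation bound and in the approximation of `L*`.
  set ε : ℕ → ℝ := fun k => 1 / ((k : ℝ) + 1) with hε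
  have hε0 : ∀ k, 0 < ε k := fun k => Nat.one_div_pos_of_nat
  have hε1 : ∀ k, ε k ≤ 1 := fun k => by
    simp only [hε]
    rw [div_le_one (by positivity)]
    linarith [Nat.cast_nonneg (α := ℝ) k]
  have hdev : ∀ᵐ ω ∂P, ∀ k, ∀ᶠ n : ℕ in atTop,
      MAPE.risk MAPE.mapeLoss ν (ghat n (fun i : Fin n => Zs i ω)) ≤
        MAPE.empiricalRisk MAPE.mapeLoss (fun i : Fin n => Zs i ω)
          (ghat n (fun i : Fin n => Zs i ω)) + ENNReal.ofReal (ε k) :=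
    ae_all_iff.2 fun k => MAPE.ae_eventually_risk_le hZmeas hZindep hlaw hYL hν hGmeas
      (fun n hn => (hV n hn).le) hb0 hGb ghat hghat_meas hghat_mem (hε0 k) (hε1 k)
      (MAPE.summable_deviation_bound hbtop hrate hδ hgrowth hYL (hε0 k))
  have happrox : ∀ k, ∃ g m, 1 ≤ m ∧ g ∈ G m ∧ MAPE.risk MAPE.mapeLoss ν g <
      MAPE.optimalRisk MAPE.mapeLoss ν + ENNReal.ofReal (ε k) := fun k => by
    obtain ⟨g, hg, hlt⟩ := MAPE.exists_risk_lt ν hYL hν (S := ⋃ n ≥ 1, G n)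
      (fun g hg => by
        simp only [Set.mem_iUnion, exists_prop] at hg
        obtain ⟨m, hm, hgm⟩ := hg
        exact hGmeas m hm g hgm) hGdense (hε0 k)
    simp only [Set.mem_iUnion, exists_prop] at hg
    obtain ⟨m, hm, hgm⟩ := hg
    exact ⟨g, m, hm, hgm, hlt⟩
  choose gs ms hms hgs hrisk using happrox
  have hlln : ∀ᵐ ω ∂P, ∀ k, Tendsto
      (fun n : ℕ => MAPE.empiricalRisk MAPE.mapeLoss (fun i : Fin n => Zs i ω) (gs k)) atTop
      (𝓝 (MAPE.risk MAPE.mapeLoss ν (gs k))) :=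
    ae_all_iff.2 fun k => MAPE.ae_tendsto_empiricalRisk hZmeas hZindep hlaw hYL hν
      (hGmeas _ (hms k) _ (hgs k)) (hb0 (ms k)) (hGb _ (hms k) _ (hgs k))
  have herm : ∀ᵐ ω ∂P, ∀ n, 1 ≤ n → MAPE.IsERM MAPE.mapeLoss (G n) (fun i : Fin n => Zs i ω)
      (ghat n (fun i : Fin n => Zs i ω)) :=
    ae_all_iff.2 fun n => eventually_all.2 fun hn => hghat_erm n hn
  filter_upwards [hdev, hlln, herm] with ω hdevω hllnω hermω
  refine tendsto_order.2 ⟨fun a ha => ?_, fun a ha => ?_⟩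
  · filter_upwards [eventually_ge_atTop 1] with n hn
    exact ha.trans_le (iInf₂_le _ (hGmeas n hn _ (hghat_mem n hn _)))
  · have hεlim : Tendsto (fun k => MAPE.optimalRisk MAPE.mapeLoss ν + ENNReal.ofReal (ε k) +
        ENNReal.ofReal (ε k)) atTop (𝓝 (MAPE.optimalRisk MAPE.mapeLoss ν)) := by
      have h0 : Tendsto (fun k => ENNReal.ofReal (ε k)) atTop (𝓝 0) := by
        rw [← ENNReal.ofReal_zero]
        exact ENNReal.tendsto_ofReal tendsto_one_div_add_atTop_nhds_zero_nat
      simpa using (tendsto_const_nhds.add h0).add h0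
    obtain ⟨k, hk⟩ := (hεlim.eventually_lt_const ha).exists
    filter_upwards [hdevω k, (hllnω k).eventually_lt_const (hrisk k), eventually_ge_atTop (ms k)]
      with n hn1 hn2 hn3
    refine lt_of_le_of_lt (hn1.trans ?_) hk
    gcongr
    have hmem : gs k ∈ G n := MAPE.subset_of_le hGmono (hms k) hn3 (hgs k)
    exact ((hermω n ((hms k).trans hn3)).2 _ hmem).trans hn2.le
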